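/- Let $\mathbb X$ be a finite set and let $Q=(q(x,y))_{x,y\in\mathbb X}$ be the generator of an irreducible continuous-time Markov chain on $\mathbb X$, with stationary distribution $\pi$ (the probability vector with $\pi Q=0$). Let $\pi_0$ be a probability on $\mathbb X$, let $(X_t)_{t\ge 0}$ be a Markov chain with generator $Q$ and initial distribution $\pi_0$, with almost surely right-continuous paths having left limits ($\mathbb X$ being discrete), let $\pi_t=\pi_0e^{tQ}$ be the distribution of $X_t$, and let $d(t)=\|\pi_t-\pi\|_{TV}=\sup_{A\subset\mathbb X}|\pi_t(A)-\pi(A)|$. Write $\wedge$ for the pointwise minimum, and let measures act on matrices from the left, $(\mu Q)(x)=\sum_y\mu(y)q(y,x)$. Put $\psi_0(x)=\frac{(\pi_0\wedge\pi)(x)}{\pi_0(x)}$ if $\pi_0(x)\neq 0$ and $\psi_0(x)=1$ otherwise, and for $t\ge 0$ $$J_t=\begin{cases}0&\text{if there is } s\in[0,t] \text{ with } \pi_s(X_s)\le\pi(X_s),\\ (1-\psi_0(X_0))\exp\left(\int_0^t\frac{((\pi_s\wedge\pi)Q)(X_s)}{\pi_s(X_s)-\pi(X_s)}\,ds\right)&\text{otherwise.}\end{cases}$$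 Let $U$ be uniformly distributed on $[0,1]$ and independent of $(X_t)_{t\ge 0}$, and let $T=\inf\{t\ge 0: U\ge J_t\}\in[0,\infty]$. Then: 1. for all $t\ge 0$, $d(t)=\mathbb P(T>t)$; 2. for all $t\ge 0$ and $x\in\mathbb X$, $\mathbb P(T\le t,\ X_t=x)=(\pi_t\wedge\pi)(x)$; 3. for all $t\ge 0$ and $x\in\mathbb X$, $\mathbb P(T\le t,\ X_T=x)=(\pi_t\wedge\pi)(x)-\int_0^t((\pi_s\wedge\pi)Q)(x)\,ds$; 4. $T<\infty$ almost surely, the density $\mathbf 1_{\{\pi_s(x)<\pi(x)\}}(\pi_sQ)(x)-((\pi_s\wedge\pi)Q)(x)$ is nonnegative for all $s\ge 0$ and $x\in\mathbb X$, and the distribution $\nu$ of $(T,X_T)$ on $[0,\infty]\times\mathbb X$ is $$\nu(ds,x)=(\pi_0\wedge\pi)(x)\,\delta_0(ds)+\left(\mathbf 1_{\{\pi_s(x)<\pi(x)\}}(\pi_sQ)(x)-((\pi_s\wedge\pi)Q)(x)\right)ds,$$ where $ds$ is Lebesgue measure on $[0,\infty)$. -/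

import Mathlib

open MeasureTheory ProbabilityTheory Set Filter Topology
open scoped NNReal ENNReal Matrix

noncomputable section

namespace OptStop

variable {S : Type*} [Fintype S] [DecidableEq S] {Ω : Type*} [MeasurableSpace Ω]

/-- `Q` is the generator of an irreducible continuous-time Markov chain on the finite set `S`:
nonnegative off-diagonal rates, zero row sums, and any state can be reached from any other one
along transitions of positive rate (diagonal entries are nonpositive, so they play no role). -/
structure IsIrreducibleGenerator (Q : Matrix S S ℝ) : Prop where
  nonneg_off_diag : ∀ x y, x ≠ y → 0 ≤ Q x y
  row_sum : ∀ x, ∑ y, Q x y = 0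
  irreducible : ∀ x y, Relation.ReflTransGen (fun a b => 0 < Q a b) x y

/-- `π` is a stationary distribution of `Q`: a probability vector with `π Q = 0`. -/
structure IsStationary (Q : Matrix S S ℝ) (π : S → ℝ) : Prop where
  prob : π ∈ stdSimplex ℝ S
  stationary : π ᵥ* Q = 0

/-- The transition matrix `exp (t Q)`. -/
def transition (Q : Matrix S S ℝ) (t : ℝ) : Matrix S S ℝ := NormedSpace.exp (t • Q)

/-- `X` is, under `P`, a continuous-time Markov chain with generator `Q` and initial
distribution `p0`, with paths that are almost surely right-continuous with left limits for the
discrete topology of `S`. The law is given by the finite-dimensional distributions. -/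
structure IsMarkovChain [MeasurableSpace S] (P : Measure Ω) (X : ℝ≥0 → Ω → S) (p0 : S → ℝ)
    (Q : Matrix S S ℝ) : Prop where
  measurable : ∀ t, Measurable (X t)
  fdd : ∀ (n : ℕ) (t : Fin (n + 1) → ℝ≥0), Monotone t → t 0 = 0 → ∀ x : Fin (n + 1) → S,
    P.real {ω | ∀ i, X (t i) ω = x i} =
      p0 (x 0) * ∏ i : Fin n,
        transition Q ((t i.succ : ℝ) - (t i.castSucc : ℝ)) (x i.castSucc) (x i.succ)
  rightCts : ∀ᵐ ω ∂P, ∀ t, ∀ᶠ s in 𝓝[>] t, X s ω = X t ω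
  leftLim : ∀ᵐ ω ∂P, ∀ t, ∃ x, ∀ᶠ s in 𝓝[<] t, X s ω = x

/-- `π_t = π_0 exp (t Q)`, the distribution at time `t`. -/
def marg (p0 : S → ℝ) (Q : Matrix S S ℝ) (t : ℝ) : S → ℝ := p0 ᵥ* transition Q t

/-- Total variation distance between two probability vectors: the supremum over all events. -/
def tv (p q : S → ℝ) : ℝ := ⨆ A : Finset S, |∑ x ∈ A, p x - ∑ x ∈ A, q x|

/-- `ψ_0 = (π_0 ∧ π) / π_0` where `π_0` does not vanish, and `1` elsewhere. -/
def psi0 (p0 π : S → ℝ) (x : S) : ℝ :=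
  open scoped Classical in if p0 x = 0 then 1 else (p0 ⊓ π) x / p0 x

/-- `((π_s ∧ π) Q)(x)`. -/
def minFlow (p0 π : S → ℝ) (Q : Matrix S S ℝ) (s : ℝ) : S → ℝ := (marg p0 Q s ⊓ π) ᵥ* Q

/-- The functional `J_t`: it is `0` if `π_s(X_s) ≤ π(X_s)` for some `s ∈ [0, t]`, and
`(1 - ψ_0(X_0)) exp (∫_0^t (π_s ∧ π)Q(X_s) / (π_s(X_s) - π(X_s)) ds)` otherwise. -/
def J (p0 π : S → ℝ) (Q : Matrix S S ℝ) (X : ℝ≥0 → Ω → S) (t : ℝ≥0) (ω : Ω) : ℝ :=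
  open scoped Classical in
  if ∃ s : ℝ≥0, s ≤ t ∧ marg p0 Q s (X s ω) ≤ π (X s ω) then 0
  else (1 - psi0 p0 π (X 0 ω)) *
    Real.exp (∫ s in (0 : ℝ)..t,
      minFlow p0 π Q s (X s.toNNReal ω) /
        (marg p0 Q s (X s.toNNReal ω) - π (X s.toNNReal ω)))

/-- `T = inf {t ≥ 0 | U ≥ J_t}`, with values in `[0, ∞]`. -/
def stopTime (p0 π : S → ℝ) (Q : Matrix S S ℝ) (X : ℝ≥0 → Ω → S) (U : Ω → ℝ) (ω : Ω) : ℝ≥0∞ :=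
  ⨅ (t : ℝ≥0) (_ : J p0 π Q X t ω ≤ U ω), (t : ℝ≥0∞)

/-- `X_T`, the state at a random time; the value on `{T = ∞}` is arbitrary. -/
def stoppedState (X : ℝ≥0 → Ω → S) (T : Ω → ℝ≥0∞) (ω : Ω) : S := X (T ω).toNNReal ω

/-- The density `1_{π_s(x) < π(x)} (π_s Q)(x) - ((π_s ∧ π) Q)(x)`. -/
def stopDensity (p0 π : S → ℝ) (Q : Matrix S S ℝ) (s : ℝ) (x : S) : ℝ :=
  {r : ℝ | marg p0 Q r x < π x}.indicator (fun r => (marg p0 Q r ᵥ* Q) x) s - minFlow p0 π Q s x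

/-- The measure `ν` on `[0, ∞] × S` given by
`ν(ds, x) = (π_0 ∧ π)(x) δ_0(ds) + (1_{π_s(x) < π(x)} π_s Q(x) - (π_s ∧ π) Q(x)) ds`,
where `ds` is Lebesgue measure on `[0, ∞)`. -/
def stopLaw [MeasurableSpace S] (p0 π : S → ℝ) (Q : Matrix S S ℝ) : Measure (ℝ≥0∞ × S) :=
  ∑ x, (ENNReal.ofReal ((p0 ⊓ π) x) • Measure.dirac (0, x) +
    ((volume.restrict (Ici (0 : ℝ))).withDensity
      (fun s => ENNReal.ofReal (stopDensity p0 π Q s x))).map (fun s => (ENNReal.ofReal s, x)))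

end OptStop

end

/-! Write `P_h` for the transition matrix over time `h`, and split `π_s - π` into `excess` minus
`deficit`. Everything reduces to one identity: the expectation of `J_t` on `{X_t = y}` is `excess t
y`. Since `U` is uniform and independent of the chain, and `T > t` almost surely exactly when `U <
J_t`, this gives `P(T > t, X_t = y) = excess t y`. Summing over `y` yields the total variation
distance; subtracting from `π_t` yields `π_t ∧ π`.

The identity is exact on a grid. Let the chain survive a visit to `x` at the `k`-th grid time with
probability `factor`, the ratio of the new excess at `x` to the excess carried there by `P_h`. By
the Markov property these ratios telescope, and the product of the factors has expectation exactly
`excess` on each event `{X_{nh} = y}` (`IsMarkovChain.setIntegral_chainProd`). Now take `h = t / n`.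
Because `π Q = 0`, the logarithm of a factor is `h * minFlow / gap + O(h ^ 2)` where the gap `π_s -
π` is bounded below, so the product tends to the exponential in `J_t`. If the path meets `{π_s ≤
π}`, the product tends to `0`. Dominated convergence carries the identity to the limit.

The delicate point is a path that meets `{π_s ≤ π}` only for an instant, or only through a left
limit. This can mislead the grid only if the path jumps at a time isolated on one side in the set
`{s | π_s(x) ≤ π(x)}` of some state. Such times are deterministic and countable
(`exceptionalTimes`), and the chain almost surely jumps at none of them
(`IsMarkovChain.ae_isGoodPath`).

For the law of `(T, X_T)`, approximate `T` from the right by grid times. Since `P(T ≤ s, X_{s+h} =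
x) = ((π_s ∧ π) P_h)(x)`, the probability of stopping at `x` in one step is the increment of `π_s ∧
π` minus `h * minFlow + O(h ^ 2)`; summation gives a telescoping sum and a Riemann sum. The density
follows because `π_s(x) ∧ π(x)` is differentiable off a countable set, and finiteness of `T` because
`π_t` converges to `π` by Doeblin's minorization. -/

set_option linter.unusedSectionVars false

namespace OptStop

/-! ### Transition matrices: positivity and expansions in time -/

section TransitionMatrix

variable {S : Type*} [Fintype S] [DecidableEq S]

attribute [local instance] Matrix.linftyOpNormedRing Matrix.linftyOpNormedAlgebra in
theorem hasSum_exp_apply (A : Matrix S S ℝ) (x y : S) :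
    HasSum (fun n : ℕ => ((n.factorial : ℝ)⁻¹) * (A ^ n) x y) (NormedSpace.exp A x y) := by
  have h := NormedSpace.exp_series_hasSum_exp' (𝕂 := ℝ) A
  have h2 := (h.map (Matrix.entryAddHom ℝ x y) (by exact (continuous_id.matrix_elem x y)))
  exact h2

attribute [local instance] Matrix.linftyOpNormedRing Matrix.linftyOpNormedAlgebra in
theorem hasDerivAt_transition (Q : Matrix S S ℝ) (t : ℝ) (x y : S) :
    HasDerivAt (fun s => transition Q s x y) ((transition Q t * Q) x y) t := by
  have h := hasDerivAt_exp_smul_const (𝕂 := ℝ) Q t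
  have := (Matrix.entryLinearMap ℝ ℝ x y).toContinuousLinearMap.hasFDerivAt.comp_hasDerivAt t h
  exact this

attribute [local instance] Matrix.linftyOpNormedRing Matrix.linftyOpNormedAlgebra in
theorem hasDerivAt_transition' (Q : Matrix S S ℝ) (t : ℝ) (x y : S) :
    HasDerivAt (fun s => transition Q s x y) ((Q * transition Q t) x y) t := by
  have h := hasDerivAt_exp_smul_const' (𝕂 := ℝ) Q t
  have := (Matrix.entryLinearMap ℝ ℝ x y).toContinuousLinearMap.hasFDerivAt.comp_hasDerivAt t h
  exact this

theorem transition_add (Q : Matrix S S ℝ) (s t : ℝ) :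
    transition Q (s + t) = transition Q s * transition Q t := by
  unfold transition
  rw [add_smul]
  exact Matrix.exp_add_of_commute _ _ ((Commute.refl Q).smul_left _ |>.smul_right _)

@[simp]
theorem transition_zero (Q : Matrix S S ℝ) : transition Q 0 = 1 := by
  simp [transition]

theorem pow_apply_nonneg {A : Matrix S S ℝ} (hA : ∀ x y, 0 ≤ A x y) (n : ℕ) (x y : S) :
    0 ≤ (A ^ n) x y := by
  induction n generalizing x y with
  | zero => rw [pow_zero, Matrix.one_apply]; split_ifs <;> norm_num
  | succ n ih =>
    rw [pow_succ, Matrix.mul_apply]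
    exact Finset.sum_nonneg fun z _ => mul_nonneg (ih x z) (hA z y)

theorem pow_apply_le_exp_apply {A : Matrix S S ℝ} (hA : ∀ x y, 0 ≤ A x y) (n : ℕ) (x y : S) :
    ((n.factorial : ℝ)⁻¹) * (A ^ n) x y ≤ NormedSpace.exp A x y :=
  le_hasSum (hasSum_exp_apply A x y) n fun m _ =>
    mul_nonneg (by positivity) (pow_apply_nonneg hA m x y)

/-- A uniform bound for the exit rates. -/
noncomputable def rate (Q : Matrix S S ℝ) : ℝ := ∑ x, |Q x x|

/-- The sum of the absolute values of all rates. -/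
noncomputable def totalRate (Q : Matrix S S ℝ) : ℝ := ∑ x, ∑ y, |Q x y|

theorem rate_nonneg (Q : Matrix S S ℝ) : 0 ≤ rate Q := Finset.sum_nonneg fun _ _ => abs_nonneg _

theorem totalRate_nonneg (Q : Matrix S S ℝ) : 0 ≤ totalRate Q :=
  Finset.sum_nonneg fun _ _ => Finset.sum_nonneg fun _ _ => abs_nonneg _

theorem sum_abs_col_le_totalRate (Q : Matrix S S ℝ) (y : S) : ∑ x, |Q x y| ≤ totalRate Q :=
  Finset.sum_le_sum fun x _ =>
    Finset.single_le_sum (f := fun z => |Q x z|) (fun _ _ => abs_nonneg _) (Finset.mem_univ y)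

/-- The nonnegative matrix obtained by adding the uniform bound to the diagonal. -/
noncomputable def uniformized (Q : Matrix S S ℝ) : Matrix S S ℝ := Q + Matrix.diagonal fun _ => rate Q

theorem uniformized_nonneg {Q : Matrix S S ℝ} (hQ : ∀ x y, x ≠ y → 0 ≤ Q x y) (x y : S) :
    0 ≤ uniformized Q x y := by
  rw [uniformized, Matrix.add_apply]
  rcases eq_or_ne x y with rfl | h
  · rw [Matrix.diagonal_apply_eq]
    have := Finset.single_le_sum (f := fun z => |Q z z|) (fun _ _ => abs_nonneg _)
      (Finset.mem_univ x)
    have h2 := neg_abs_le (Q x x)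
    simp only [rate]
    linarith
  · rw [Matrix.diagonal_apply_ne _ h, add_zero]
    exact hQ x y h

/-- Uniformization: adding a scalar matrix commutes with everything and makes the rates nonnegative,
so any single term of the exponential series bounds the sum below. Nonnegativity, the diagonal lower
bound and irreducible positivity all come from here. -/
theorem transition_eq_uniformized (Q : Matrix S S ℝ) (t : ℝ) (x y : S) :
    transition Q t x y = Real.exp (-(rate Q * t)) *
      NormedSpace.exp (t • uniformized Q) x y := by
  have h1 : t • Q = Matrix.diagonal (fun _ => -(rate Q * t)) +
      t • uniformized Q := by
    ext i j
    simp only [uniformized, Matrix.add_apply, Matrix.smul_apply, smul_eq_mul]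
    rcases eq_or_ne i j with rfl | h
    · simp only [Matrix.diagonal_apply_eq]; ring
    · simp only [Matrix.diagonal_apply_ne _ h]; ring
  have hc : Commute (Matrix.diagonal (fun _ : S => -(rate Q * t)))
      (t • uniformized Q) := by
    have : Matrix.diagonal (fun _ : S => -(rate Q * t)) = (-(rate Q * t)) • (1 : Matrix S S ℝ) := by
      rw [Matrix.smul_one_eq_diagonal]
    rw [this]
    exact (Commute.one_left _).smul_left _
  unfold transition
  rw [h1, Matrix.exp_add_of_commute _ _ hc, Matrix.exp_diagonal, Matrix.diagonal_mul,
    Pi.coe_exp, Real.exp_eq_exp_ℝ]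

variable {Q : Matrix S S ℝ}

theorem transition_nonneg (hQ : ∀ x y, x ≠ y → 0 ≤ Q x y) {t : ℝ} (ht : 0 ≤ t) (x y : S) :
    0 ≤ transition Q t x y := by
  rw [transition_eq_uniformized]
  have hA : ∀ x y, 0 ≤ (t • uniformized Q) x y := fun x y => by
    rw [Matrix.smul_apply]; exact mul_nonneg ht (uniformized_nonneg hQ x y)
  exact mul_nonneg (Real.exp_pos _).le
    ((mul_nonneg (by positivity) (pow_apply_nonneg hA 0 x y)).trans
      (pow_apply_le_exp_apply hA 0 x y))

theorem exp_neg_le_transition_self (hQ : ∀ x y, x ≠ y → 0 ≤ Q x y) {t : ℝ} (ht : 0 ≤ t) (x : S) :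
    Real.exp (-(rate Q * t)) ≤ transition Q t x x := by
  rw [transition_eq_uniformized]
  have hA : ∀ x y, 0 ≤ (t • uniformized Q) x y := fun x y => by
    rw [Matrix.smul_apply]; exact mul_nonneg ht (uniformized_nonneg hQ x y)
  have := pow_apply_le_exp_apply hA 0 x x
  simp only [Nat.factorial_zero, Nat.cast_one, inv_one, pow_zero, Matrix.one_apply_eq,
    one_mul] at this
  nlinarith [Real.exp_pos (-(rate Q * t))]

theorem exists_pow_apply_pos {A : Matrix S S ℝ} (hA : ∀ x y, 0 ≤ A x y) {x y : S}
    (h : Relation.ReflTransGen (fun a b => 0 < A a b) x y) : ∃ n : ℕ, 0 < (A ^ n) x y := by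
  induction h with
  | refl => exact ⟨0, by simp⟩
  | @tail b c _ hbc ih =>
    obtain ⟨n, hn⟩ := ih
    refine ⟨n + 1, ?_⟩
    rw [pow_succ, Matrix.mul_apply]
    exact lt_of_lt_of_le (mul_pos hn hbc)
      (Finset.single_le_sum (f := fun z => (A ^ n) x z * A z c)
        (fun z _ => mul_nonneg (pow_apply_nonneg hA n x z) (hA z c)) (Finset.mem_univ b))

/-- A chain of positive rates makes some power of the uniformized matrix positive at `(x, y)`, and
that one term of the series suffices. -/
theorem IsIrreducibleGenerator.transition_pos (hQ : IsIrreducibleGenerator Q) (x y : S) :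
    0 < transition Q 1 x y := by
  rw [transition_eq_uniformized, one_smul]
  have hA := uniformized_nonneg hQ.nonneg_off_diag
  have hmono : ∀ a b, 0 < Q a b → 0 < uniformized Q a b := by
    intro a b hab
    rw [uniformized, Matrix.add_apply]
    refine add_pos_of_pos_of_nonneg hab ?_
    rw [Matrix.diagonal_apply]
    split_ifs
    · exact rate_nonneg Q
    · exact le_rfl
  obtain ⟨n, hn⟩ := exists_pow_apply_pos hA (Relation.ReflTransGen.mono hmono _ _ (hQ.irreducible x y))
  exact mul_pos (Real.exp_pos _)
    (lt_of_lt_of_le (mul_pos (by positivity) hn) (pow_apply_le_exp_apply hA n x y))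

theorem transition_row_sum (hQ : ∀ x, ∑ y, Q x y = 0) (t : ℝ) (x : S) :
    ∑ y, transition Q t x y = 1 := by
  have hd : ∀ s, HasDerivAt (fun s => ∑ y, transition Q s x y) 0 s := by
    intro s
    have h := HasDerivAt.fun_sum fun (y : S) (_ : y ∈ Finset.univ) => hasDerivAt_transition Q s x y
    refine h.congr_deriv ?_
    simp only [Matrix.mul_apply]
    rw [Finset.sum_comm]
    exact Finset.sum_eq_zero fun z _ => by rw [← Finset.mul_sum, hQ, mul_zero]
  have := is_const_of_deriv_eq_zero (fun s => (hd s).differentiableAt) (fun s => (hd s).deriv) t 0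
  simpa [Matrix.one_apply] using this

theorem IsIrreducibleGenerator.transition_le_one (hQ : IsIrreducibleGenerator Q) {t : ℝ}
    (ht : 0 ≤ t) (x y : S) : transition Q t x y ≤ 1 := by
  rw [← transition_row_sum hQ.row_sum t x]
  exact Finset.single_le_sum (fun z _ => transition_nonneg hQ.nonneg_off_diag ht x z)
    (Finset.mem_univ y)

theorem IsStationary.vecMul_transition {π : S → ℝ} (hπ : IsStationary Q π) (t : ℝ) :
    π ᵥ* transition Q t = π := by
  ext y
  have hd : ∀ s, HasDerivAt (fun s => (π ᵥ* transition Q s) y) 0 s := by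
    intro s
    have h := HasDerivAt.fun_sum fun (x : S) (_ : x ∈ Finset.univ) =>
      (hasDerivAt_transition' Q s x y).const_mul (π x)
    have e : (π ᵥ* (Q * transition Q s)) y = 0 := by
      rw [← Matrix.vecMul_vecMul, hπ.stationary, Matrix.zero_vecMul]; rfl
    rw [← e]
    exact h
  have := is_const_of_deriv_eq_zero (fun s => (hd s).differentiableAt) (fun s => (hd s).deriv) t 0
  simpa using this

theorem abs_transition_mul_apply_le (hQ : IsIrreducibleGenerator Q) {t : ℝ} (ht : 0 ≤ t)
    (x y : S) : |(transition Q t * Q) x y| ≤ totalRate Q := by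
  rw [Matrix.mul_apply]
  refine (Finset.abs_sum_le_sum_abs _ _).trans ?_
  refine le_trans (Finset.sum_le_sum fun z _ => ?_) (sum_abs_col_le_totalRate Q y)
  rw [abs_mul, abs_of_nonneg (transition_nonneg hQ.nonneg_off_diag ht x z)]
  exact mul_le_of_le_one_left (abs_nonneg _) (hQ.transition_le_one ht x z)

theorem abs_transition_sub_one_le (hQ : IsIrreducibleGenerator Q) {t : ℝ} (ht : 0 ≤ t)
    (x y : S) : |transition Q t x y - (1 : Matrix S S ℝ) x y| ≤ totalRate Q * t := by
  have := (convex_Icc 0 t).norm_image_sub_le_of_norm_hasDerivWithin_le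
    (fun s _ => (hasDerivAt_transition Q s x y).hasDerivWithinAt)
    (fun s hs => by rw [Real.norm_eq_abs]; exact abs_transition_mul_apply_le hQ hs.1 x y)
    (left_mem_Icc.2 ht) (right_mem_Icc.2 ht)
  simpa [abs_of_nonneg ht] using this

/-- The remainder has derivative `(P_s - 1) Q`, which the first-order bound makes at most `totalRate
Q ^ 2 * t` on `[0, t]`. -/
theorem abs_transition_sub_one_sub_le (hQ : IsIrreducibleGenerator Q) {t : ℝ} (ht : 0 ≤ t)
    (x y : S) : |transition Q t x y - (1 : Matrix S S ℝ) x y - t * Q x y| ≤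
      totalRate Q ^ 2 * t ^ 2 := by
  have hd : ∀ s, HasDerivAt (fun s => transition Q s x y - (1 : Matrix S S ℝ) x y - s * Q x y)
      (((transition Q s - 1) * Q) x y) s := by
    intro s
    have := ((hasDerivAt_transition Q s x y).sub_const ((1 : Matrix S S ℝ) x y)).sub
      ((hasDerivAt_id s).mul_const (Q x y))
    refine this.congr_deriv ?_
    rw [sub_mul, one_mul, one_mul, Matrix.sub_apply]
  have := (convex_Icc 0 t).norm_image_sub_le_of_norm_hasDerivWithin_le
    (C := totalRate Q ^ 2 * t)
    (fun s _ => (hd s).hasDerivWithinAt)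
    (fun s hs => by
      rw [Real.norm_eq_abs, Matrix.mul_apply]
      refine (Finset.abs_sum_le_sum_abs _ _).trans ?_
      calc ∑ z, |(transition Q s - 1) x z * Q z y|
          ≤ ∑ z, (totalRate Q * t) * |Q z y| := by
            refine Finset.sum_le_sum fun z _ => ?_
            rw [abs_mul]
            refine mul_le_mul_of_nonneg_right ?_ (abs_nonneg _)
            exact (abs_transition_sub_one_le hQ hs.1 x z).trans
              (mul_le_mul_of_nonneg_left hs.2 (totalRate_nonneg Q))
        _ ≤ (totalRate Q * t) * totalRate Q := by
            rw [← Finset.mul_sum]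
            exact mul_le_mul_of_nonneg_left (sum_abs_col_le_totalRate Q y)
              (mul_nonneg (totalRate_nonneg Q) ht)
        _ = _ := by ring)
    (left_mem_Icc.2 ht) (right_mem_Icc.2 ht)
  simp only [transition_zero, sub_self, zero_mul, sub_zero, Real.norm_eq_abs, abs_of_nonneg ht]
    at this
  linarith [this]

end TransitionMatrix

/-! ### Excess, deficit and the flow of the minimum -/

section Marginals

variable {S : Type*} [Fintype S] [DecidableEq S]

/-- The signed difference `π_s - π`. -/
noncomputable def gap (p0 π : S → ℝ) (Q : Matrix S S ℝ) (s : ℝ) : S → ℝ := marg p0 Q s - π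

/-- The positive part of `π_s - π`. -/
noncomputable def excess (p0 π : S → ℝ) (Q : Matrix S S ℝ) (s : ℝ) : S → ℝ := fun x => max (gap p0 π Q s x) 0

/-- The negative part of `π_s - π`. -/
noncomputable def deficit (p0 π : S → ℝ) (Q : Matrix S S ℝ) (s : ℝ) : S → ℝ :=
  fun x => max (-gap p0 π Q s x) 0

variable {p0 π : S → ℝ} {Q : Matrix S S ℝ}

theorem marg_zero : marg p0 Q 0 = p0 := by simp [marg]

theorem marg_add (s t : ℝ) : marg p0 Q (s + t) = marg p0 Q s ᵥ* transition Q t := by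
  simp [marg, transition_add, Matrix.vecMul_vecMul]

theorem hasDerivAt_marg (s : ℝ) (x : S) :
    HasDerivAt (fun s => marg p0 Q s x) ((marg p0 Q s ᵥ* Q) x) s := by
  have h := HasDerivAt.fun_sum fun (y : S) (_ : y ∈ Finset.univ) =>
    (hasDerivAt_transition Q s y x).const_mul (p0 y)
  rw [marg, Matrix.vecMul_vecMul]
  exact h

theorem hasDerivAt_gap (s : ℝ) (x : S) :
    HasDerivAt (fun s => gap p0 π Q s x) ((marg p0 Q s ᵥ* Q) x) s :=
  (hasDerivAt_marg s x).sub_const (π x)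

theorem continuous_marg (x : S) : Continuous fun s => marg p0 Q s x :=
  continuous_iff_continuousAt.2 fun s => (hasDerivAt_marg s x).continuousAt

theorem continuous_gap (x : S) : Continuous fun s => gap p0 π Q s x :=
  (continuous_marg x).sub continuous_const

theorem continuous_excess (x : S) : Continuous fun s => excess p0 π Q s x :=
  (continuous_gap x).max continuous_const

theorem continuous_minFlow (x : S) : Continuous fun s => minFlow p0 π Q s x := by
  refine continuous_finsetSum _ fun y _ => ?_
  exact ((continuous_marg y).min continuous_const).mul continuous_const

theorem marg_nonneg (hQ : IsIrreducibleGenerator Q) (hp0 : p0 ∈ stdSimplex ℝ S) {s : ℝ}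
    (hs : 0 ≤ s) (x : S) : 0 ≤ marg p0 Q s x :=
  Finset.sum_nonneg fun y _ =>
    mul_nonneg (hp0.1 y) (transition_nonneg hQ.nonneg_off_diag hs y x)

theorem sum_vecMul_transition (hQ : IsIrreducibleGenerator Q) (v : S → ℝ) (s : ℝ) :
    ∑ x, (v ᵥ* transition Q s) x = ∑ x, v x := by
  simp only [Matrix.vecMul, dotProduct]
  rw [Finset.sum_comm]
  simp only [← Finset.mul_sum, transition_row_sum hQ.row_sum, mul_one]

theorem sum_marg (hQ : IsIrreducibleGenerator Q) (hp0 : p0 ∈ stdSimplex ℝ S) (s : ℝ) :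
    ∑ x, marg p0 Q s x = 1 := by
  rw [marg, sum_vecMul_transition hQ, hp0.2]

theorem le_one_of_sum_eq_one {v : S → ℝ} (hv : ∀ x, 0 ≤ v x) (h1 : ∑ x, v x = 1) (x : S) :
    v x ≤ 1 :=
  h1 ▸ Finset.single_le_sum (fun y _ => hv y) (Finset.mem_univ x)

theorem marg_le_one (hQ : IsIrreducibleGenerator Q) (hp0 : p0 ∈ stdSimplex ℝ S) {s : ℝ}
    (hs : 0 ≤ s) (x : S) : marg p0 Q s x ≤ 1 :=
  le_one_of_sum_eq_one (marg_nonneg hQ hp0 hs) (sum_marg hQ hp0 s) x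

theorem gap_add (hπ : IsStationary Q π) (s t : ℝ) :
    gap p0 π Q (s + t) = gap p0 π Q s ᵥ* transition Q t := by
  rw [gap, gap, Matrix.sub_vecMul, marg_add, hπ.vecMul_transition]

theorem sum_gap (hQ : IsIrreducibleGenerator Q) (hπ : IsStationary Q π)
    (hp0 : p0 ∈ stdSimplex ℝ S) (s : ℝ) : ∑ x, gap p0 π Q s x = 0 := by
  simp [gap, sum_marg hQ hp0, hπ.prob.2]

theorem excess_nonneg (s : ℝ) (x : S) : 0 ≤ excess p0 π Q s x := le_max_right _ _

theorem deficit_nonneg (s : ℝ) (x : S) : 0 ≤ deficit p0 π Q s x := le_max_right _ _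

theorem excess_eq_zero {s : ℝ} {x : S} (h : gap p0 π Q s x ≤ 0) : excess p0 π Q s x = 0 :=
  max_eq_right h

theorem excess_eq_gap {s : ℝ} {x : S} (h : 0 ≤ gap p0 π Q s x) :
    excess p0 π Q s x = gap p0 π Q s x :=
  max_eq_left h

theorem deficit_eq_zero {s : ℝ} {x : S} (h : 0 ≤ gap p0 π Q s x) : deficit p0 π Q s x = 0 :=
  max_eq_right (by linarith)

theorem gap_eq_excess_sub_deficit (s : ℝ) :
    gap p0 π Q s = excess p0 π Q s - deficit p0 π Q s := by
  ext x
  simp only [excess, deficit, Pi.sub_apply]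
  rcases le_total (gap p0 π Q s x) 0 with h | h
  · rw [max_eq_right h, max_eq_left (by linarith)]; ring
  · rw [max_eq_left h, max_eq_right (by linarith)]; ring

theorem marg_inf_eq_sub_excess (s : ℝ) : marg p0 Q s ⊓ π = marg p0 Q s - excess p0 π Q s := by
  ext x
  simp only [excess, gap, Pi.sub_apply, Pi.inf_apply]
  rcases le_total (marg p0 Q s x) (π x) with h | h
  · rw [inf_of_le_left h, max_eq_right (by linarith)]; ring
  · rw [inf_of_le_right h, max_eq_left (by linarith)]; ring

theorem marg_inf_eq_sub_deficit (s : ℝ) : marg p0 Q s ⊓ π = π - deficit p0 π Q s := by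
  rw [marg_inf_eq_sub_excess]
  have := gap_eq_excess_sub_deficit (p0 := p0) (π := π) (Q := Q) s
  rw [gap] at this
  linear_combination (exp := 1) this

/-- Stationarity removes `π` from `π_s ∧ π = π - deficit`. Hence the flow at a state without deficit
comes only from other states and has a sign. -/
theorem minFlow_eq_neg_deficit (hπ : IsStationary Q π) (s : ℝ) :
    minFlow p0 π Q s = -(deficit p0 π Q s ᵥ* Q) := by
  rw [minFlow, marg_inf_eq_sub_deficit, Matrix.sub_vecMul, hπ.stationary, zero_sub]

theorem marg_inf_nonneg (hQ : IsIrreducibleGenerator Q) (hπ : IsStationary Q π)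
    (hp0 : p0 ∈ stdSimplex ℝ S) {s : ℝ} (hs : 0 ≤ s) (x : S) : 0 ≤ (marg p0 Q s ⊓ π) x :=
  le_inf (marg_nonneg hQ hp0 hs x) (hπ.prob.1 x)

theorem marg_inf_le_one (hπ : IsStationary Q π) (s : ℝ) (x : S) : (marg p0 Q s ⊓ π) x ≤ 1 :=
  inf_le_right.trans (le_one_of_sum_eq_one hπ.prob.1 hπ.prob.2 x)

theorem deficit_le_one (hQ : IsIrreducibleGenerator Q) (hπ : IsStationary Q π)
    (hp0 : p0 ∈ stdSimplex ℝ S) {s : ℝ} (hs : 0 ≤ s) (x : S) : deficit p0 π Q s x ≤ 1 := by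
  refine max_le ?_ zero_le_one
  have h1 := marg_nonneg hQ hp0 hs x
  have h2 := le_one_of_sum_eq_one hπ.prob.1 hπ.prob.2 x
  simp only [gap, Pi.sub_apply]
  linarith

theorem vecMul_apply_nonneg_of_apply_eq_zero (hQ : IsIrreducibleGenerator Q) {v : S → ℝ}
    (hv : ∀ y, 0 ≤ v y) {x : S} (hx : v x = 0) : 0 ≤ (v ᵥ* Q) x := by
  refine Finset.sum_nonneg fun y _ => ?_
  rcases eq_or_ne y x with rfl | h
  · rw [hx, zero_mul]
  · exact mul_nonneg (hv y) (hQ.nonneg_off_diag y x h)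

theorem minFlow_nonpos (hQ : IsIrreducibleGenerator Q) (hπ : IsStationary Q π) {s : ℝ} {x : S}
    (h : 0 ≤ gap p0 π Q s x) : minFlow p0 π Q s x ≤ 0 := by
  rw [minFlow_eq_neg_deficit hπ, Pi.neg_apply, neg_nonpos]
  exact vecMul_apply_nonneg_of_apply_eq_zero hQ (deficit_nonneg s) (deficit_eq_zero h)

theorem abs_vecMul_le {v : S → ℝ} {c : ℝ} (hv : ∀ y, |v y| ≤ c) (x : S) :
    |(v ᵥ* Q) x| ≤ c * totalRate Q := by
  have hc : 0 ≤ c := (abs_nonneg _).trans (hv x)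
  refine (Finset.abs_sum_le_sum_abs _ _).trans ?_
  refine le_trans ?_ (mul_le_mul_of_nonneg_left (sum_abs_col_le_totalRate Q x) hc)
  rw [Finset.mul_sum]
  refine Finset.sum_le_sum fun y _ => ?_
  rw [abs_mul]
  exact mul_le_mul_of_nonneg_right (hv y) (abs_nonneg _)

theorem abs_minFlow_le (hQ : IsIrreducibleGenerator Q) (hπ : IsStationary Q π)
    (hp0 : p0 ∈ stdSimplex ℝ S) {s : ℝ} (hs : 0 ≤ s) (x : S) :
    |minFlow p0 π Q s x| ≤ totalRate Q := by
  refine (abs_vecMul_le (c := 1) (fun y => ?_) x).trans (one_mul _).le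
  rw [abs_of_nonneg (marg_inf_nonneg hQ hπ hp0 hs y)]
  exact marg_inf_le_one hπ s y

theorem abs_gap_sub_le (hQ : IsIrreducibleGenerator Q) (hp0 : p0 ∈ stdSimplex ℝ S) {s t : ℝ}
    (hs : 0 ≤ s) (ht : 0 ≤ t) (x : S) :
    |gap p0 π Q t x - gap p0 π Q s x| ≤ totalRate Q * |t - s| := by
  refine (convex_Ici (0 : ℝ)).norm_image_sub_le_of_norm_hasDerivWithin_le
    (fun r _ => (hasDerivAt_gap r x).hasDerivWithinAt) (fun r hr => ?_) hs ht
  refine (abs_vecMul_le (c := 1) (fun y => ?_) x).trans (one_mul _).le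
  rw [abs_of_nonneg (marg_nonneg hQ hp0 hr y)]
  exact marg_le_one hQ hp0 hr y

theorem abs_deficit_sub_le (hQ : IsIrreducibleGenerator Q) (hp0 : p0 ∈ stdSimplex ℝ S) {s t : ℝ}
    (hs : 0 ≤ s) (ht : 0 ≤ t) (x : S) :
    |deficit p0 π Q t x - deficit p0 π Q s x| ≤ totalRate Q * |t - s| := by
  refine (abs_max_sub_max_le_abs _ _ _).trans ?_
  rw [neg_sub_neg, abs_sub_comm]
  exact abs_gap_sub_le hQ hp0 hs ht x

/-- The gap evolves linearly under `P_t`; what the transported excess has beyond the new gap is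
exactly the transported deficit. This controls the denominator of `factor`. -/
theorem excess_vecMul_transition (hπ : IsStationary Q π) (s t : ℝ) (x : S) :
    (excess p0 π Q s ᵥ* transition Q t) x =
      gap p0 π Q (s + t) x + (deficit p0 π Q s ᵥ* transition Q t) x := by
  rw [gap_add hπ, gap_eq_excess_sub_deficit, Matrix.sub_vecMul, Pi.sub_apply]
  ring

theorem vecMul_transition_nonneg (hQ : IsIrreducibleGenerator Q) {v : S → ℝ}
    (hv : ∀ y, 0 ≤ v y) {t : ℝ} (ht : 0 ≤ t) (x : S) : 0 ≤ (v ᵥ* transition Q t) x :=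
  Finset.sum_nonneg fun y _ => mul_nonneg (hv y) (transition_nonneg hQ.nonneg_off_diag ht y x)

theorem excess_add_le (hQ : IsIrreducibleGenerator Q) (hπ : IsStationary Q π) {t : ℝ}
    (ht : 0 ≤ t) (s : ℝ) (x : S) :
    excess p0 π Q (s + t) x ≤ (excess p0 π Q s ᵥ* transition Q t) x := by
  refine max_le ?_ (vecMul_transition_nonneg hQ (excess_nonneg s) ht x)
  rw [excess_vecMul_transition hπ]
  linarith [vecMul_transition_nonneg hQ (deficit_nonneg (p0 := p0) (π := π) (Q := Q) s) ht x]

theorem abs_vecMul_transition_sub_le (hQ : IsIrreducibleGenerator Q) {v : S → ℝ}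
    (hv : ∀ y, |v y| ≤ 1) {h : ℝ} (hh : 0 ≤ h) (x : S) :
    |(v ᵥ* transition Q h) x - v x - h * (v ᵥ* Q) x| ≤
      Fintype.card S * totalRate Q ^ 2 * h ^ 2 := by
  have e : (v ᵥ* transition Q h) x - v x - h * (v ᵥ* Q) x =
      ∑ y, v y * (transition Q h y x - (1 : Matrix S S ℝ) y x - h * Q y x) := by
    have e1 : v x = ∑ y, v y * (1 : Matrix S S ℝ) y x := by
      have := congrFun (Matrix.vecMul_one v) x
      exact this.symm
    rw [e1]
    simp only [Matrix.vecMul, dotProduct, mul_sub, Finset.sum_sub_distrib, Finset.mul_sum]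
    congr 1
    exact Finset.sum_congr rfl fun y _ => by ring
  rw [e]
  refine (Finset.abs_sum_le_sum_abs _ _).trans ?_
  refine (Finset.sum_le_card_nsmul _ _ (totalRate Q ^ 2 * h ^ 2) fun y _ => ?_).trans ?_
  · rw [abs_mul]
    exact (mul_le_of_le_one_left (abs_nonneg _) (hv y)).trans
      (abs_transition_sub_one_sub_le hQ hh y x)
  · rw [Finset.card_univ, nsmul_eq_mul, mul_assoc]

/-- A constant controlling second-order errors in the time step. -/
noncomputable def secondOrderConst (Q : Matrix S S ℝ) : ℝ := (Fintype.card S + 1) * totalRate Q ^ 2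

theorem secondOrderConst_nonneg : 0 ≤ secondOrderConst Q := by
  unfold secondOrderConst; positivity

/-- The flow is taken at the right end `s + h`, where the factors are evaluated. The constant is
`card S * totalRate Q ^ 2` from the Taylor remainder plus `totalRate Q ^ 2` for moving the Lipschitz
deficit from `s` to `s + h`. -/
theorem abs_deficit_vecMul_add_le (hQ : IsIrreducibleGenerator Q) (hπ : IsStationary Q π)
    (hp0 : p0 ∈ stdSimplex ℝ S) {s h : ℝ} (hs : 0 ≤ s) (hh : 0 ≤ h) (x : S) :
    |(deficit p0 π Q s ᵥ* transition Q h) x - deficit p0 π Q s x +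
      h * minFlow p0 π Q (s + h) x| ≤ secondOrderConst Q * h ^ 2 := by
  have h1 := abs_vecMul_transition_sub_le hQ (v := deficit p0 π Q s) (fun y => by
    rw [abs_of_nonneg (deficit_nonneg s y)]; exact deficit_le_one hQ hπ hp0 hs y) hh x
  have h2 : |((deficit p0 π Q (s + h) - deficit p0 π Q s) ᵥ* Q) x| ≤
      (totalRate Q * h) * totalRate Q := by
    refine abs_vecMul_le (fun y => ?_) x
    have := abs_deficit_sub_le (π := π) hQ hp0 hs (add_nonneg hs hh) y
    rwa [add_sub_cancel_left, abs_of_nonneg hh] at this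
  rw [Matrix.sub_vecMul, Pi.sub_apply] at h2
  rw [minFlow_eq_neg_deficit hπ, Pi.neg_apply]
  unfold secondOrderConst
  rw [abs_le] at *
  constructor <;> nlinarith [mul_le_mul_of_nonneg_left h2.1 hh, mul_le_mul_of_nonneg_left h2.2 hh]

theorem abs_marg_inf_vecMul_sub_le (hQ : IsIrreducibleGenerator Q) (hπ : IsStationary Q π)
    (hp0 : p0 ∈ stdSimplex ℝ S) {s h : ℝ} (hs : 0 ≤ s) (hh : 0 ≤ h) (x : S) :
    |((marg p0 Q s ⊓ π) ᵥ* transition Q h) x - (marg p0 Q s ⊓ π) x -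
      h * minFlow p0 π Q (s + h) x| ≤ secondOrderConst Q * h ^ 2 := by
  rw [marg_inf_eq_sub_deficit, Matrix.sub_vecMul, hπ.vecMul_transition, ← abs_neg]
  refine le_of_eq_of_le ?_ (abs_deficit_vecMul_add_le hQ hπ hp0 hs hh x)
  congr 1
  simp only [Pi.sub_apply]
  ring

end Marginals

/-! ### Convergence to equilibrium and the stopping density -/

section Convergence

variable {S : Type*} [Fintype S] [DecidableEq S] {p0 π : S → ℝ} {Q : Matrix S S ℝ}

/-- The supremum is attained on `{p > q}`; negative values of `p(A) - q(A)` are handled by passing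
to the complement. -/
theorem tv_eq_sum_max {p q : S → ℝ} (h : ∑ x, (p x - q x) = 0) :
    tv p q = ∑ x, max (p x - q x) 0 := by
  have hle : ∀ A : Finset S, ∑ x ∈ A, (p x - q x) ≤ ∑ x, max (p x - q x) 0 := fun A =>
    (Finset.sum_le_sum fun x _ => le_max_left _ _).trans
      (Finset.sum_le_univ_sum_of_nonneg fun x => le_max_right (p x - q x) 0)
  have hbd : ∀ A : Finset S,
      |∑ x ∈ A, p x - ∑ x ∈ A, q x| ≤ ∑ x, max (p x - q x) 0 := by
    intro A
    rw [← Finset.sum_sub_distrib, abs_le]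
    refine ⟨?_, hle A⟩
    have h1 := Finset.sum_add_sum_compl A fun x => p x - q x
    linarith [hle Aᶜ]
  refine le_antisymm (ciSup_le hbd) ?_
  refine le_ciSup_of_le ⟨_, forall_mem_range.2 hbd⟩ (Finset.univ.filter fun x => 0 < p x - q x) ?_
  rw [← Finset.sum_sub_distrib, Finset.sum_filter]
  refine le_trans (Finset.sum_le_sum fun x _ => ?_) (le_abs_self _)
  split_ifs with hx
  · exact (max_eq_left hx.le).le
  · exact (max_eq_right (not_lt.1 hx)).le

theorem tv_marg (hQ : IsIrreducibleGenerator Q) (hπ : IsStationary Q π)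
    (hp0 : p0 ∈ stdSimplex ℝ S) (t : ℝ) : tv (marg p0 Q t) π = ∑ x, excess p0 π Q t x :=
  tv_eq_sum_max (sum_gap hQ hπ hp0 t)

/-- Doeblin's argument: excess and deficit have equal mass, and in unit time each puts at least `c`
times that mass on every state, where the two shares cancel. -/
theorem sum_excess_add_one_le (hQ : IsIrreducibleGenerator Q) (hπ : IsStationary Q π)
    (hp0 : p0 ∈ stdSimplex ℝ S) {c : ℝ} (hc : ∀ x y, c ≤ transition Q 1 x y) (s : ℝ) :
    ∑ x, excess p0 π Q (s + 1) x ≤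
      (1 - Fintype.card S * c) * ∑ x, excess p0 π Q s x := by
  have hsum : ∑ x, excess p0 π Q s x = ∑ x, deficit p0 π Q s x := by
    have := sum_gap hQ hπ hp0 s
    rw [gap_eq_excess_sub_deficit] at this
    simpa [sub_eq_zero] using this
  have hle : ∀ x, excess p0 π Q (s + 1) x ≤
      (excess p0 π Q s ᵥ* transition Q 1) x - c * ∑ y, excess p0 π Q s y := by
    intro x
    have key : ∀ {v : S → ℝ}, (∀ y, 0 ≤ v y) → c * ∑ y, v y ≤ (v ᵥ* transition Q 1) x := by
      intro v hv
      rw [Finset.mul_sum]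
      refine Finset.sum_le_sum fun y _ => ?_
      rw [mul_comm]
      exact mul_le_mul_of_nonneg_left (hc y x) (hv y)
    refine max_le ?_ ?_
    · have := key (deficit_nonneg (p0 := p0) (π := π) (Q := Q) s)
      rw [excess_vecMul_transition hπ, hsum]
      linarith
    · exact sub_nonneg.2 (key (excess_nonneg s))
  refine (Finset.sum_le_sum fun x _ => hle x).trans (le_of_eq ?_)
  rw [Finset.sum_sub_distrib, sum_vecMul_transition hQ, Finset.sum_const, Finset.card_univ,
    nsmul_eq_mul]
  ring

theorem tendsto_sum_excess (hQ : IsIrreducibleGenerator Q) (hπ : IsStationary Q π)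
    (hp0 : p0 ∈ stdSimplex ℝ S) :
    Tendsto (fun n : ℕ => ∑ x, excess p0 π Q n x) atTop (𝓝 0) := by
  have hne : Nonempty S := by
    by_contra h
    rw [not_nonempty_iff] at h
    have := hp0.2
    simp at this
  obtain ⟨⟨a, b⟩, hab⟩ := Finite.exists_min fun z : S × S => transition Q 1 z.1 z.2
  set c := transition Q 1 a b with hcdef
  have hc0 : 0 < c := hQ.transition_pos a b
  have hc : ∀ x y, c ≤ transition Q 1 x y := fun x y => hab (x, y)
  have hcard : 0 < (Fintype.card S : ℝ) := by exact_mod_cast Fintype.card_pos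
  have hr0 : 0 ≤ 1 - Fintype.card S * c := by
    have := Finset.card_nsmul_le_sum Finset.univ (fun y => transition Q 1 a y) c
      fun y _ => hc a y
    rw [transition_row_sum hQ.row_sum, Finset.card_univ, nsmul_eq_mul] at this
    linarith
  have hr1 : 1 - Fintype.card S * c < 1 := by nlinarith
  have hbound : ∀ n : ℕ, ∑ x, excess p0 π Q n x ≤
      (1 - Fintype.card S * c) ^ n * ∑ x, excess p0 π Q 0 x := by
    intro n
    induction n with
    | zero => simp
    | succ n ih =>
      rw [Nat.cast_succ, pow_succ']
      refine (sum_excess_add_one_le hQ hπ hp0 hc n).trans ?_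
      rw [mul_assoc]
      exact mul_le_mul_of_nonneg_left ih hr0
  refine squeeze_zero (fun n => Finset.sum_nonneg fun x _ => excess_nonneg _ x) hbound ?_
  simpa using (tendsto_pow_atTop_nhds_zero_of_lt_one hr0 hr1).mul_const
    (∑ x, excess p0 π Q 0 x)

/-- Where `π_s(x) < π(x)` the density is the flow of the excess into a state without excess;
elsewhere it is the flow of the deficit into a state without deficit. Only off-diagonal rates enter
either flow. -/
theorem stopDensity_nonneg (hQ : IsIrreducibleGenerator Q) (hπ : IsStationary Q π) (s : ℝ)
    (x : S) : 0 ≤ stopDensity p0 π Q s x := by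
  unfold stopDensity
  by_cases h : marg p0 Q s x < π x
  · rw [indicator_of_mem (show s ∈ {r : ℝ | marg p0 Q r x < π x} from h), sub_nonneg]
    refine sub_nonneg.1 ?_
    have e : (marg p0 Q s ᵥ* Q) x - minFlow p0 π Q s x = (excess p0 π Q s ᵥ* Q) x := by
      rw [minFlow, marg_inf_eq_sub_excess, Matrix.sub_vecMul, Pi.sub_apply]
      ring
    rw [e]
    refine vecMul_apply_nonneg_of_apply_eq_zero hQ (excess_nonneg s) (excess_eq_zero ?_)
    simp only [gap, Pi.sub_apply]
    linarith
  · rw [indicator_of_notMem (show s ∉ {r : ℝ | marg p0 Q r x < π x} from h), zero_sub, neg_nonneg]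
    exact minFlow_nonpos hQ hπ (sub_nonneg.2 (not_lt.1 h))

theorem continuous_marg_vecMul (x : S) : Continuous fun s => (marg p0 Q s ᵥ* Q) x :=
  continuous_finsetSum _ fun y _ => (continuous_marg y).mul continuous_const

theorem measurableSet_marg_lt (x : S) : MeasurableSet {r : ℝ | marg p0 Q r x < π x} :=
  (isOpen_lt (continuous_marg x) continuous_const).measurableSet

theorem intervalIntegrable_indicator_marg (x : S) (a b : ℝ) : IntervalIntegrable
    ({r : ℝ | marg p0 Q r x < π x}.indicator fun r => (marg p0 Q r ᵥ* Q) x) volume a b := by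
  have := (continuous_marg_vecMul (p0 := p0) (Q := Q) x).intervalIntegrable (μ := volume) a b
  exact ⟨this.1.indicator (measurableSet_marg_lt x), this.2.indicator (measurableSet_marg_lt x)⟩

theorem intervalIntegrable_stopDensity (x : S) (a b : ℝ) :
    IntervalIntegrable (fun s => stopDensity p0 π Q s x) volume a b :=
  (intervalIntegrable_indicator_marg x a b).sub ((continuous_minFlow x).intervalIntegrable a b)

/-- A zero with nonzero derivative is isolated on the right in the zero set, and any set of reals
has only countably many such points. -/
theorem countable_isolated_zeros {f f' : ℝ → ℝ} (hf : ∀ s, HasDerivAt f (f' s) s) :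
    {s | f s = 0 ∧ f' s ≠ 0}.Countable := by
  refine (countable_setOfPred_isolated_right_within (s := {s | f s = 0})).mono ?_
  rintro s ⟨h0, h1⟩
  refine ⟨h0, ?_⟩
  have := (hf s).eventually_ne (c := 0) h1
  rw [← empty_mem_iff_bot, mem_nhdsWithin_iff_eventually]
  rw [eventually_nhdsWithin_iff] at this
  filter_upwards [this] with z hz hz2
  exact hz (ne_of_gt hz2.2) hz2.1

/-- Fundamental theorem of calculus for `π_s(x) ∧ π(x)`, off the countable set where `π_s(x)`
crosses `π(x)` with nonzero speed. -/
theorem integral_indicator_marg (x : S) (t : ℝ) :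
    ∫ s in (0 : ℝ)..t, {r : ℝ | marg p0 Q r x < π x}.indicator
      (fun r => (marg p0 Q r ᵥ* Q) x) s =
      (marg p0 Q t ⊓ π) x - (p0 ⊓ π) x := by
  have hcount := countable_isolated_zeros fun s => hasDerivAt_gap (p0 := p0) (π := π) (Q := Q) s x
  have := integral_eq_of_hasDerivAt_off_countable (fun s => (marg p0 Q s ⊓ π) x)
    ({r : ℝ | marg p0 Q r x < π x}.indicator (fun r => (marg p0 Q r ᵥ* Q) x)) (a := 0) (b := t)
    hcount ((continuous_marg x).min continuous_const).continuousOn ?_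
    (intervalIntegrable_indicator_marg x 0 t)
  · rw [this, marg_zero]
  · rintro s ⟨-, hs⟩
    have hd := hasDerivAt_marg (p0 := p0) (Q := Q) s x
    have hcont := hd.continuousAt
    rcases lt_trichotomy (marg p0 Q s x) (π x) with h | h | h
    · rw [indicator_of_mem (show s ∈ {r : ℝ | marg p0 Q r x < π x} from h)]
      refine hd.congr_of_eventuallyEq ?_
      filter_upwards [hcont.eventually_lt_const h] with r hr
      exact min_eq_left hr.le
    -- At a contact with zero derivative the minimum also has derivative zero, since `|min a c - c|
    -- ≤ |a - c|`.
    · rw [indicator_of_notMem (show s ∉ {r : ℝ | marg p0 Q r x < π x} from h.not_lt)]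
      have hz : (marg p0 Q s ᵥ* Q) x = 0 := by
        by_contra hne
        exact hs ⟨sub_eq_zero.2 h, hne⟩
      rw [hz] at hd
      rw [hasDerivAt_iff_isLittleO] at hd ⊢
      refine (Asymptotics.IsBigO.of_bound 1 (Eventually.of_forall fun r => ?_)).trans_isLittleO hd
      simp only [Pi.inf_apply, h, smul_zero, sub_zero, one_mul, Real.norm_eq_abs]
      have := abs_min_sub_min_le_max (marg p0 Q r x) (π x) (π x) (π x)
      simpa using this
    · rw [indicator_of_notMem (show s ∉ {r : ℝ | marg p0 Q r x < π x} from h.not_gt)]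
      refine (hasDerivAt_const s (π x)).congr_of_eventuallyEq ?_
      filter_upwards [hcont.eventually_const_lt h] with r hr
      exact min_eq_right hr.le

theorem integral_stopDensity (x : S) (t : ℝ) :
    ∫ s in (0 : ℝ)..t, stopDensity p0 π Q s x =
      (marg p0 Q t ⊓ π) x - (p0 ⊓ π) x - ∫ s in (0 : ℝ)..t, minFlow p0 π Q s x := by
  unfold stopDensity
  rw [intervalIntegral.integral_sub (intervalIntegrable_indicator_marg x 0 t)
    ((continuous_minFlow x).intervalIntegrable 0 t), integral_indicator_marg]

end Convergence

/-! ### One-step survival factors and their logarithms -/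

section SurvivalFactor

variable {S : Type*} [Fintype S] [DecidableEq S] {p0 π : S → ℝ} {Q : Matrix S S ℝ}

/-- The probability of surviving the visit to `x` at the `k`-th time of the grid of mesh `h`. -/
noncomputable def factor (p0 π : S → ℝ) (Q : Matrix S S ℝ) (h : ℝ) : ℕ → S → ℝ
  | 0, x => 1 - psi0 p0 π x
  | k + 1, x => excess p0 π Q (k * h + h) x / (excess p0 π Q (k * h) ᵥ* transition Q h) x

theorem mul_one_sub_psi0 (hπ : ∀ x, 0 ≤ π x) (x : S) :
    p0 x * (1 - psi0 p0 π x) = excess p0 π Q 0 x := by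
  have e := congrFun (marg_inf_eq_sub_excess (p0 := p0) (π := π) (Q := Q) 0) x
  rw [Pi.sub_apply, marg_zero] at e
  unfold psi0
  split_ifs with h
  · rw [sub_self, mul_zero, excess_eq_zero]
    rw [gap, marg_zero, Pi.sub_apply, h]
    linarith [hπ x]
  · rw [e]; field_simp; ring

theorem psi0_mem_Icc (hp0 : p0 ∈ stdSimplex ℝ S) (hπ : ∀ x, 0 ≤ π x) (x : S) :
    psi0 p0 π x ∈ Icc (0 : ℝ) 1 := by
  unfold psi0
  split_ifs with h
  · simp
  · exact ⟨div_nonneg (le_inf (hp0.1 x) (hπ x)) (hp0.1 x),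
      div_le_one_of_le₀ inf_le_left (hp0.1 x)⟩

theorem psi0_eq_one (h : p0 x ≤ π x) : psi0 p0 π x = 1 := by
  unfold psi0
  split_ifs with h0
  · rfl
  · rw [Pi.inf_apply, inf_of_le_left h, div_self h0]

theorem factor_mem_Icc (hQ : IsIrreducibleGenerator Q) (hπ : IsStationary Q π)
    (hp0 : p0 ∈ stdSimplex ℝ S) {h : ℝ} (hh : 0 ≤ h) (k : ℕ) (x : S) :
    factor p0 π Q h k x ∈ Icc (0 : ℝ) 1 := by
  cases k with
  | zero =>
    have := psi0_mem_Icc hp0 hπ.prob.1 x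
    exact ⟨by simpa [factor] using this.2, by simpa [factor] using this.1⟩
  | succ k =>
    have h1 := excess_add_le (p0 := p0) hQ hπ hh (k * h) x
    have h2 := vecMul_transition_nonneg hQ
      (excess_nonneg (p0 := p0) (π := π) (Q := Q) (k * h)) hh x
    exact ⟨div_nonneg (excess_nonneg _ x) h2, div_le_one_of_le₀ h1 h2⟩

theorem factor_eq_zero {h : ℝ} {k : ℕ} {x : S} (hk : gap p0 π Q (k * h) x ≤ 0) :
    factor p0 π Q h k x = 0 := by
  cases k with
  | zero =>
    rw [Nat.cast_zero, zero_mul, gap, marg_zero, Pi.sub_apply, sub_nonpos] at hk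
    rw [factor, psi0_eq_one hk, sub_self]
  | succ k =>
    rw [Nat.cast_succ, add_mul, one_mul] at hk
    rw [factor, excess_eq_zero hk, zero_div]

/-- The identity survives a zero denominator, because the new excess is dominated by the transported
one and vanishes with it. This is the induction step for the expected survival product. -/
theorem vecMul_mul_factor (hQ : IsIrreducibleGenerator Q) (hπ : IsStationary Q π)
    {h : ℝ} (hh : 0 ≤ h) (k : ℕ) (x : S) :
    (excess p0 π Q (k * h) ᵥ* transition Q h) x * factor p0 π Q h (k + 1) x =
      excess p0 π Q ((k + 1 : ℕ) * h) x := by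
  rw [Nat.cast_succ, add_mul, one_mul, factor]
  refine mul_div_cancel_of_imp' fun h0 => ?_
  exact le_antisymm ((excess_add_le hQ hπ hh (k * h) x).trans h0.le) (excess_nonneg _ x)

theorem abs_log_one_add_sub_le {u : ℝ} (hu : 0 ≤ u) : |Real.log (1 + u) - u| ≤ u ^ 2 := by
  have h1 := Real.log_le_sub_one_of_pos (show 0 < 1 + u by linarith)
  have h2 := Real.one_sub_inv_le_log_of_pos (show 0 < 1 + u by linarith)
  have h3 : 1 - (1 + u)⁻¹ - u + u ^ 2 = u ^ 3 / (1 + u) := by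
    field_simp; ring
  have h4 : 0 ≤ u ^ 3 / (1 + u) := by positivity
  rw [abs_le]
  constructor <;> nlinarith

/-- With `g` the gap and `r` the transported deficit, the factor is `(1 + r / g)⁻¹` and `r = -h *
minFlow + O(h ^ 2)`. The two terms of the constant come from this error and from replacing `log (1 +
u)` by `u`. -/
theorem abs_log_factor_sub_le (hQ : IsIrreducibleGenerator Q) (hπ : IsStationary Q π)
    (hp0 : p0 ∈ stdSimplex ℝ S) {h δ : ℝ} (hh : 0 ≤ h) (hδ : 0 < δ) (hhδ : totalRate Q * h ≤ δ)
    {k : ℕ} {x : S} (hgap : δ ≤ gap p0 π Q ((k + 1 : ℕ) * h) x) :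
    0 < factor p0 π Q h (k + 1) x ∧
    |Real.log (factor p0 π Q h (k + 1) x) -
      h * (minFlow p0 π Q ((k + 1 : ℕ) * h) x / gap p0 π Q ((k + 1 : ℕ) * h) x)| ≤
      (secondOrderConst Q / δ + (totalRate Q + secondOrderConst Q * h) ^ 2 / δ ^ 2) * h ^ 2 := by
  rw [Nat.cast_succ, add_mul, one_mul] at *
  have hkh : 0 ≤ (k : ℝ) * h := by positivity
  set g := gap p0 π Q (k * h + h) x with hg
  set M := minFlow p0 π Q (k * h + h) x with hM
  set K := totalRate Q
  set C := secondOrderConst Q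
  have hgpos : 0 < g := hδ.trans_le hgap
  have hC : 0 ≤ C := secondOrderConst_nonneg
  -- The gap is `totalRate Q`-Lipschitz, so a gap of at least `δ ≥ totalRate Q * h` cannot have been
  -- negative one step earlier; the deficit at `x` therefore starts from zero.
  have hprev : 0 ≤ gap p0 π Q (k * h) x := by
    have := abs_gap_sub_le (π := π) hQ hp0 hkh (add_nonneg hkh hh) x
    rw [add_sub_cancel_left, abs_of_nonneg hh, abs_le] at this
    linarith [this.2]
  set r := (deficit p0 π Q (k * h) ᵥ* transition Q h) x with hr
  have hr0 : 0 ≤ r := vecMul_transition_nonneg hQ (deficit_nonneg _) hh x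
  have hrM : |r + h * M| ≤ C * h ^ 2 := by
    have := abs_deficit_vecMul_add_le hQ hπ hp0 hkh hh x
    rwa [deficit_eq_zero hprev, sub_zero] at this
  have hMK : |M| ≤ K := abs_minFlow_le hQ hπ hp0 (add_nonneg hkh hh) x
  have hrK : r ≤ (K + C * h) * h := by
    have h1 := (abs_le.1 hrM).2
    have h2 := (abs_le.1 hMK).1
    nlinarith
  have hf : factor p0 π Q h (k + 1) x = (1 + r / g)⁻¹ := by
    rw [factor, excess_vecMul_transition hπ, excess_eq_gap hgpos.le, ← hr, ← hg]
    field_simp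
  set u := r / g with hu
  have hu0 : 0 ≤ u := div_nonneg hr0 hgpos.le
  refine ⟨by rw [hf]; positivity, ?_⟩
  rw [hf, Real.log_inv]
  have e : -Real.log (1 + u) - h * (M / g) = -(Real.log (1 + u) - u) - (r + h * M) / g := by
    rw [hu]; field_simp; ring
  rw [e]
  have h1 : u ^ 2 ≤ (K + C * h) ^ 2 / δ ^ 2 * h ^ 2 := by
    have : u ≤ (K + C * h) * h / δ := by
      rw [hu]
      exact div_le_div₀ (hr0.trans hrK) hrK hδ hgap
    calc u ^ 2 ≤ ((K + C * h) * h / δ) ^ 2 := pow_le_pow_left₀ hu0 this 2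
      _ = _ := by ring
  have h2 : |(r + h * M) / g| ≤ C / δ * h ^ 2 := by
    rw [abs_div, abs_of_pos hgpos]
    calc |r + h * M| / g ≤ C * h ^ 2 / δ := div_le_div₀ (by positivity) hrM hδ hgap
      _ = _ := by ring
  calc _ ≤ |-(Real.log (1 + u) - u)| + |(r + h * M) / g| := abs_sub _ _
    _ ≤ u ^ 2 + |(r + h * M) / g| := by
        rw [abs_neg]; exact add_le_add_left (abs_log_one_add_sub_le hu0) _
    _ ≤ _ := by linarith

end SurvivalFactor

/-! ### Grid times and right Riemann sums -/

section Grid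

theorem le_natCeil_div_mul {r h : ℝ} (hh : 0 < h) : r ≤ ⌈r / h⌉₊ * h :=
  (div_le_iff₀ hh).1 (Nat.le_ceil _)

theorem natCeil_div_mul_lt {r h : ℝ} (hr : 0 ≤ r) (hh : 0 < h) : ⌈r / h⌉₊ * h < r + h := by
  have := Nat.ceil_lt_add_one (div_nonneg hr hh.le)
  calc (⌈r / h⌉₊ : ℝ) * h < (r / h + 1) * h := mul_lt_mul_of_pos_right this hh
    _ = r + h := by field_simp

theorem natCeil_div_le {r t : ℝ} {n : ℕ} (hrt : r ≤ t) (ht : 0 < t) (hn : 0 < n) :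
    ⌈r / (t / n)⌉₊ ≤ n := by
  have hn' : (0 : ℝ) < n := by exact_mod_cast hn
  rw [Nat.ceil_le, div_le_iff₀ (by positivity)]
  calc r ≤ t := hrt
    _ = n * (t / n) := by field_simp

theorem tendsto_div_natCast (t : ℝ) : Tendsto (fun n : ℕ => t / n) atTop (𝓝 0) :=
  tendsto_const_div_atTop_nhds_zero_nat t

/-- Rounding up makes the grid points approach from the right, so that right-continuity is enough
later. -/
theorem tendsto_natCeil_div_mul {r t : ℝ} (hr : 0 ≤ r) (ht : 0 < t) :
    Tendsto (fun n : ℕ => (⌈r / (t / n)⌉₊ : ℝ) * (t / n)) atTop (𝓝[≥] r) := by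
  have hpos : ∀ᶠ n : ℕ in atTop, 0 < t / n := by
    filter_upwards [eventually_gt_atTop 0] with n hn
    have hn' : (0 : ℝ) < n := by exact_mod_cast hn
    positivity
  rw [tendsto_nhdsWithin_iff]
  refine ⟨tendsto_of_tendsto_of_tendsto_of_le_of_le' tendsto_const_nhds
    (g := fun _ => r) (h := fun n : ℕ => r + t / n)
    (by simpa using (tendsto_div_natCast t).const_add r) ?_ ?_, ?_⟩
  · filter_upwards [hpos] with n hn using le_natCeil_div_mul hn
  · filter_upwards [hpos] with n hn using (natCeil_div_mul_lt hr hn).le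
  · filter_upwards [hpos] with n hn using le_natCeil_div_mul hn

/-- The sum is the integral of `f` evaluated at the next grid point. These step functions converge
pointwise by right-continuity, which also gives measurability of `f`, and dominated convergence
applies. -/
theorem tendsto_riemann_sum {f : ℝ → ℝ} {t B : ℝ} (ht : 0 ≤ t)
    (hB : ∀ s ∈ Icc 0 t, |f s| ≤ B)
    (hf : ∀ s ∈ Icc 0 t, Tendsto f (𝓝[≥] s) (𝓝 (f s))) :
    IntervalIntegrable f volume 0 t ∧
    Tendsto (fun n : ℕ => ∑ k ∈ Finset.range n, t / n * f ((k + 1 : ℕ) * (t / n))) atTop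
      (𝓝 (∫ s in (0 : ℝ)..t, f s)) := by
  rcases ht.eq_or_lt with rfl | ht
  · simp
  set F : ℕ → ℝ → ℝ := fun n s => f (⌈s / (t / n)⌉₊ * (t / n)) with hF
  have hmeas : ∀ n, Measurable (F n) := fun n =>
    (measurable_from_nat (f := fun k : ℕ => f (k * (t / n)))).comp
      (Nat.measurable_ceil.comp (measurable_id.div_const _))
  have hlim : ∀ s ∈ Ioc 0 t, Tendsto (fun n => F n s) atTop (𝓝 (f s)) := fun s hs =>
    (hf s ⟨hs.1.le, hs.2⟩).comp (tendsto_natCeil_div_mul hs.1.le ht)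
  have hbound : ∀ n : ℕ, 0 < n → ∀ s ∈ Ioc 0 t, |F n s| ≤ B := by
    intro n hn s hs
    have hn' : (0 : ℝ) < n := by exact_mod_cast hn
    refine hB _ ⟨by positivity, ?_⟩
    have : (⌈s / (t / n)⌉₊ : ℝ) ≤ n := by exact_mod_cast natCeil_div_le hs.2 ht hn
    calc (⌈s / (t / n)⌉₊ : ℝ) * (t / n) ≤ n * (t / n) :=
          mul_le_mul_of_nonneg_right this (by positivity)
      _ = t := by field_simp
  have haef : AEStronglyMeasurable f (volume.restrict (Ioc 0 t)) := by
    refine aestronglyMeasurable_of_tendsto_ae atTop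
      (fun n => (hmeas n).stronglyMeasurable.aestronglyMeasurable) (f := F) ?_
    filter_upwards [ae_restrict_mem measurableSet_Ioc] with s hs using hlim s hs
  have hint : IntervalIntegrable f volume 0 t := by
    rw [intervalIntegrable_iff_integrableOn_Ioc_of_le ht.le]
    refine ⟨haef, .restrict_of_bounded (C := B) (by simp) ?_⟩
    filter_upwards [ae_restrict_mem measurableSet_Ioc] with s hs
    exact hB s ⟨hs.1.le, hs.2⟩
  refine ⟨hint, ?_⟩
  have hT : Tendsto (fun n => ∫ s in (0 : ℝ)..t, F n s) atTop (𝓝 (∫ s in (0 : ℝ)..t, f s)) := by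
    refine intervalIntegral.tendsto_integral_filter_of_dominated_convergence (fun _ => B)
      (Eventually.of_forall fun n => (hmeas n).stronglyMeasurable.aestronglyMeasurable) ?_
      intervalIntegrable_const ?_
    · filter_upwards [eventually_gt_atTop 0] with n hn
      refine ae_of_all _ fun s hs => ?_
      rw [uIoc_of_le ht.le] at hs
      exact hbound n hn s hs
    · refine ae_of_all _ fun s hs => ?_
      rw [uIoc_of_le ht.le] at hs
      exact hlim s hs
  refine hT.congr' ?_
  filter_upwards [eventually_gt_atTop 0] with n hn
  have hn' : (0 : ℝ) < n := by exact_mod_cast hn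
  have hh : 0 < t / n := by positivity
  have hpiece : ∀ k : ℕ, ∀ s ∈ uIoc ((k : ℝ) * (t / n)) ((k + 1 : ℕ) * (t / n)),
      F n s = f ((k + 1 : ℕ) * (t / n)) := by
    intro k s hs
    rw [uIoc_of_le (by push_cast; nlinarith)] at hs
    have : ⌈s / (t / n)⌉₊ = k + 1 := by
      rw [Nat.ceil_eq_iff (by simp)]
      refine ⟨?_, (div_le_iff₀ hh).2 hs.2⟩
      rw [lt_div_iff₀ hh]
      simpa using hs.1
    simp only [hF, this]
  have hadd := intervalIntegral.sum_integral_adjacent_intervals (f := F n) (μ := volume)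
    (a := fun k : ℕ => (k : ℝ) * (t / n)) (n := n) (fun k _ => by
      refine (intervalIntegrable_const (c := f ((k + 1 : ℕ) * (t / n)))).congr ?_
      exact fun s hs => (hpiece k s hs).symm)
  have e : (n : ℝ) * (t / n) = t := by field_simp
  simp only [Nat.cast_zero, zero_mul, e] at hadd
  rw [← hadd]
  refine Finset.sum_congr rfl fun k _ => ?_
  rw [intervalIntegral.integral_congr_ae (ae_of_all _ (hpiece k)), intervalIntegral.integral_const,
    smul_eq_mul]
  push_cast
  ring

end Grid

/-! ### The survival product along a path that does not cross -/

section Paths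

variable {S : Type*} [Fintype S] [DecidableEq S]

/-- Times at which `π_s(x) ≤ π(x)` for some state `x` but not just before, or not just after. -/
def exceptionalTimes (p0 π : S → ℝ) (Q : Matrix S S ℝ) : Set ℝ :=
  ⋃ x, ({s ∈ {s | gap p0 π Q s x ≤ 0} | 𝓝[{s | gap p0 π Q s x ≤ 0} ∩ Ioi s] s = ⊥} ∪
    {s ∈ {s | gap p0 π Q s x ≤ 0} | 𝓝[{s | gap p0 π Q s x ≤ 0} ∩ Iio s] s = ⊥})

variable {p0 π : S → ℝ} {Q : Matrix S S ℝ}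

theorem countable_exceptionalTimes : (exceptionalTimes p0 π Q).Countable :=
  countable_iUnion fun _ =>
    countable_setOfPred_isolated_right_within.union countable_setOfPred_isolated_left_within

/-- A path that is right-continuous with left limits and does not jump at exceptional times. -/
structure IsGoodPath (p0 π : S → ℝ) (Q : Matrix S S ℝ) (η : ℝ → S) : Prop where
  right : ∀ t, ∀ᶠ s in 𝓝[>] t, η s = η t
  left : ∀ t, ∃ x, ∀ᶠ s in 𝓝[<] t, η s = x
  no_jump : ∀ t ∈ exceptionalTimes p0 π Q, ∀ᶠ s in 𝓝[<] t, η s = η t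

/-- The product of the survival factors along a path, on the grid of mesh `h`. -/
noncomputable def survivalProd (p0 π : S → ℝ) (Q : Matrix S S ℝ) (h : ℝ) (η : ℝ → S) (n : ℕ) : ℝ :=
  ∏ k ∈ Finset.range (n + 1), factor p0 π Q h k (η (k * h))

variable {η : ℝ → S}

theorem IsGoodPath.eventually_ge (hη : IsGoodPath p0 π Q η) (t : ℝ) :
    ∀ᶠ s in 𝓝[≥] t, η s = η t := by
  rw [← Ioi_insert, nhdsWithin_insert, eventually_sup]
  exact ⟨by simp, hη.right t⟩

/-- Positivity at every time does not suffice for a path with jumps: the gap could vanish along a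
left limit. Local bounds on both sides of each time are patched together by compactness. -/
theorem IsGoodPath.exists_gap_lower_bound (hη : IsGoodPath p0 π Q η) {t : ℝ}
    (h : ∀ s ∈ Icc 0 t, 0 < gap p0 π Q s (η s)) :
    ∃ δ > 0, ∀ s ∈ Icc 0 t, δ ≤ gap p0 π Q s (η s) := by
  have key := (isCompact_Icc (a := (0 : ℝ)) (b := t)).induction_on
    (p := fun A => ∃ δ > 0, ∀ s ∈ A, s ∈ Icc 0 t → δ ≤ gap p0 π Q s (η s))
    ⟨1, one_pos, by simp⟩
    (fun A B hAB ⟨δ, hδ, hB⟩ => ⟨δ, hδ, fun s hs => hB s (hAB hs)⟩)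
    (fun A B ⟨δ, hδ, hA⟩ ⟨ε, hε, hB⟩ => ⟨min δ ε, lt_min hδ hε, fun s hs hst =>
      hs.elim (fun hs => (min_le_left _ _).trans (hA s hs hst))
        fun hs => (min_le_right _ _).trans (hB s hs hst)⟩)
    ?_
  · obtain ⟨δ, hδ, H⟩ := key
    exact ⟨δ, hδ, fun s hs => H s hs hs⟩
  intro s hs
  have hcont : ∀ x {c : ℝ}, c < gap p0 π Q s x → ∀ᶠ r in 𝓝 s, c < gap p0 π Q r x := fun x c hc =>
    (continuous_gap x).continuousAt.eventually_const_lt hc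
  have hright : ∃ δ > 0, ∀ᶠ r in 𝓝[≥] s, r ∈ Icc 0 t → δ ≤ gap p0 π Q r (η r) := by
    refine ⟨_, half_pos (h s hs), ?_⟩
    filter_upwards [hη.eventually_ge s, nhdsWithin_le_nhds (hcont (η s) (half_lt_self (h s hs)))]
      with r hr hr2 _
    rw [hr]; exact hr2.le
  have hleft : ∃ δ > 0, ∀ᶠ r in 𝓝[<] s, r ∈ Icc 0 t → δ ≤ gap p0 π Q r (η r) := by
    rcases hs.1.eq_or_lt with rfl | hs0
    · refine ⟨1, one_pos, ?_⟩
      filter_upwards [self_mem_nhdsWithin] with r hr hr2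
      exact absurd hr2.1 (not_le.2 hr)
    obtain ⟨x, hx⟩ := hη.left s
    -- If the left limit `x` had nonpositive gap at `s`, then, as the gap at `x` is positive just
    -- before `s`, the time `s` would be exceptional. The path would not jump there, so `x = η s`,
    -- contradicting the hypothesis.
    have hpos : 0 < gap p0 π Q s x := by
      by_contra hneg
      rw [not_lt] at hneg
      have hex : s ∈ exceptionalTimes p0 π Q := by
        refine mem_iUnion.2 ⟨x, Or.inr ⟨hneg, ?_⟩⟩
        rw [inter_comm, ← empty_mem_iff_bot, mem_nhdsWithin_iff_eventually]
        have h1 : ∀ᶠ r in 𝓝[<] s, 0 < r := nhdsWithin_le_nhds (lt_mem_nhds hs0)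
        have h2 := hx.and h1
        rw [eventually_nhdsWithin_iff] at h2
        filter_upwards [h2] with r hr hr2
        have h3 := hr hr2.1
        have h4 := h r ⟨h3.2.le, (mem_Iio.1 hr2.1).le.trans hs.2⟩
        rw [h3.1] at h4
        exact absurd hr2.2 (not_le.2 h4)
      obtain ⟨r, hr1, hr2⟩ := (hx.and (hη.no_jump s hex)).exists
      rw [← hr1, hr2] at hneg
      exact absurd (h s hs) (not_lt.2 hneg)
    refine ⟨_, half_pos hpos, ?_⟩
    filter_upwards [hx, nhdsWithin_le_nhds (hcont x (half_lt_self hpos))] with r hr hr2 _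
    rw [hr]; exact hr2.le
  obtain ⟨δ, hδ, H1⟩ := hright
  obtain ⟨ε, hε, H2⟩ := hleft
  refine ⟨{r | r ∈ Icc 0 t → min δ ε ≤ gap p0 π Q r (η r)}, mem_nhdsWithin_of_mem_nhds ?_,
    min δ ε, lt_min hδ hε, fun r hr => hr⟩
  rw [← nhdsLT_sup_nhdsGE, mem_sup]
  exact ⟨H2.mono fun r hr hrt => (min_le_right _ _).trans (hr hrt),
    H1.mono fun r hr hrt => (min_le_left _ _).trans (hr hrt)⟩

theorem IsGoodPath.tendsto_potential (hη : IsGoodPath p0 π Q η) {s : ℝ}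
    (hs : gap p0 π Q s (η s) ≠ 0) :
    Tendsto (fun r => minFlow p0 π Q r (η r) / gap p0 π Q r (η r)) (𝓝[≥] s)
      (𝓝 (minFlow p0 π Q s (η s) / gap p0 π Q s (η s))) := by
  have : Tendsto (fun r => minFlow p0 π Q r (η s) / gap p0 π Q r (η s)) (𝓝[≥] s)
      (𝓝 (minFlow p0 π Q s (η s) / gap p0 π Q s (η s))) :=
    ((continuous_minFlow (η s)).continuousAt.div (continuous_gap (η s)).continuousAt
      hs).tendsto.mono_left nhdsWithin_le_nhds
  refine this.congr' ?_
  filter_upwards [hη.eventually_ge s] with r hr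
  rw [hr]

theorem IsGoodPath.tendsto_riemann_potential (hQ : IsIrreducibleGenerator Q)
    (hπ : IsStationary Q π) (hp0 : p0 ∈ stdSimplex ℝ S) (hη : IsGoodPath p0 π Q η) {t : ℝ}
    (ht : 0 ≤ t) (h : ∀ s ∈ Icc 0 t, 0 < gap p0 π Q s (η s)) :
    IntervalIntegrable (fun s => minFlow p0 π Q s (η s) / gap p0 π Q s (η s)) volume 0 t ∧
    Tendsto (fun n : ℕ => ∑ k ∈ Finset.range n, t / n *
      (minFlow p0 π Q ((k + 1 : ℕ) * (t / n)) (η ((k + 1 : ℕ) * (t / n))) /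
        gap p0 π Q ((k + 1 : ℕ) * (t / n)) (η ((k + 1 : ℕ) * (t / n))))) atTop
      (𝓝 (∫ s in (0 : ℝ)..t, minFlow p0 π Q s (η s) / gap p0 π Q s (η s))) := by
  obtain ⟨δ, hδ, H⟩ := hη.exists_gap_lower_bound h
  refine tendsto_riemann_sum (B := totalRate Q / δ)
    (f := fun s => minFlow p0 π Q s (η s) / gap p0 π Q s (η s)) ht (fun s hs => ?_)
    fun s hs => hη.tendsto_potential (h s hs).ne'
  rw [abs_div, abs_of_pos (h s hs)]
  exact div_le_div₀ (totalRate_nonneg Q) (abs_minFlow_le hQ hπ hp0 hs.1 _) hδ (H s hs)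

theorem natCast_mul_div_mem_Icc {k n : ℕ} {t : ℝ} (ht : 0 ≤ t) (hk : k ≤ n) :
    (k : ℝ) * (t / n) ∈ Icc 0 t := by
  refine ⟨by positivity, ?_⟩
  rcases Nat.eq_zero_or_pos n with rfl | hn
  · simpa using ht
  have hn' : (0 : ℝ) < n := by exact_mod_cast hn
  have hk' : (k : ℝ) ≤ n := by exact_mod_cast hk
  calc (k : ℝ) * (t / n) ≤ n * (t / n) := mul_le_mul_of_nonneg_right hk' (by positivity)
    _ = t := by field_simp

/-- The gap stays above some `δ > 0`, so the logarithm of the product differs from a Riemann sum by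
`n` errors of order `(t / n) ^ 2`. -/
theorem IsGoodPath.tendsto_survivalProd_of_pos (hQ : IsIrreducibleGenerator Q)
    (hπ : IsStationary Q π) (hp0 : p0 ∈ stdSimplex ℝ S) (hη : IsGoodPath p0 π Q η) {t : ℝ}
    (ht : 0 ≤ t) (h : ∀ s ∈ Icc 0 t, 0 < gap p0 π Q s (η s)) :
    Tendsto (fun n : ℕ => survivalProd p0 π Q (t / n) η n) atTop
      (𝓝 ((1 - psi0 p0 π (η 0)) * Real.exp
        (∫ s in (0 : ℝ)..t, minFlow p0 π Q s (η s) / gap p0 π Q s (η s)))) := by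
  obtain ⟨δ, hδ, H⟩ := hη.exists_gap_lower_bound h
  have hR := (hη.tendsto_riemann_potential hQ hπ hp0 ht h).2
  set R : ℕ → ℝ := fun n => ∑ k ∈ Finset.range n, t / n *
      (minFlow p0 π Q ((k + 1 : ℕ) * (t / n)) (η ((k + 1 : ℕ) * (t / n))) /
        gap p0 π Q ((k + 1 : ℕ) * (t / n)) (η ((k + 1 : ℕ) * (t / n)))) with hRdef
  set Lg : ℕ → ℝ := fun n => ∑ k ∈ Finset.range n,
    Real.log (factor p0 π Q (t / n) (k + 1) (η ((k + 1 : ℕ) * (t / n)))) with hL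
  set C := secondOrderConst Q
  set K := totalRate Q
  have hC : 0 ≤ C := secondOrderConst_nonneg
  have hK : 0 ≤ K := totalRate_nonneg Q
  have hmesh : ∀ᶠ n : ℕ in atTop, K * (t / n) ≤ δ := by
    have := ((tendsto_div_natCast t).const_mul K).eventually_le_const
      (show K * 0 < δ by simpa using hδ)
    exact this
  have hstep : ∀ᶠ n : ℕ in atTop, 0 < n ∧ ∀ k < n,
      0 < factor p0 π Q (t / n) (k + 1) (η ((k + 1 : ℕ) * (t / n))) ∧
      |Real.log (factor p0 π Q (t / n) (k + 1) (η ((k + 1 : ℕ) * (t / n)))) - t / n *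
      (minFlow p0 π Q ((k + 1 : ℕ) * (t / n)) (η ((k + 1 : ℕ) * (t / n))) /
        gap p0 π Q ((k + 1 : ℕ) * (t / n)) (η ((k + 1 : ℕ) * (t / n))))| ≤
      (C / δ + (K + C * t) ^ 2 / δ ^ 2) * (t / n) ^ 2 := by
    filter_upwards [hmesh, eventually_gt_atTop 0] with n hn hn0
    refine ⟨hn0, fun k hk => ?_⟩
    have hh : 0 ≤ t / n := by positivity
    have hmem := natCast_mul_div_mem_Icc (n := n) ht (Nat.succ_le_of_lt hk)
    -- Allows `t` in place of the mesh inside the constant, which then does not depend on `n`.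
    have hle : t / n ≤ t := div_le_self ht (by exact_mod_cast hn0)
    obtain ⟨h1, h2⟩ := abs_log_factor_sub_le hQ hπ hp0 hh hδ hn (H _ hmem)
    refine ⟨h1, h2.trans ?_⟩
    gcongr
  have hdiff : Tendsto (fun n => Lg n - R n) atTop (𝓝 0) := by
    refine squeeze_zero_norm' (a := fun n : ℕ =>
      (C / δ + (K + C * t) ^ 2 / δ ^ 2) * t * (t / n)) ?_ ?_
    · filter_upwards [hstep] with n hn
      have hn' : (0 : ℝ) < n := by exact_mod_cast hn.1
      rw [hL, hRdef]
      simp only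
      rw [← Finset.sum_sub_distrib, Real.norm_eq_abs]
      refine (Finset.abs_sum_le_sum_abs _ _).trans ?_
      refine (Finset.sum_le_card_nsmul _ _ _ fun k hk =>
        (hn.2 k (Finset.mem_range.1 hk)).2).trans (le_of_eq ?_)
      rw [Finset.card_range, nsmul_eq_mul]
      field_simp
    · simpa using (tendsto_div_natCast t).const_mul ((C / δ + (K + C * t) ^ 2 / δ ^ 2) * t)
  have hLT : Tendsto Lg atTop
      (𝓝 (∫ s in (0 : ℝ)..t, minFlow p0 π Q s (η s) / gap p0 π Q s (η s))) := by
    simpa using hdiff.add hR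
  refine (((Real.continuous_exp.tendsto _).comp hLT).const_mul
    (1 - psi0 p0 π (η 0))).congr' ?_
  filter_upwards [hstep] with n hn
  rw [survivalProd, Finset.prod_range_succ', mul_comm]
  congr 1
  · simp only [Function.comp, hL]
    rw [Real.exp_sum]
    exact Finset.prod_congr rfl fun k hk => Real.exp_log (hn.2 k (Finset.mem_range.1 hk)).1
  · simp [factor]

theorem survivalProd_mem_Icc (hQ : IsIrreducibleGenerator Q) (hπ : IsStationary Q π)
    (hp0 : p0 ∈ stdSimplex ℝ S) {h : ℝ} (hh : 0 ≤ h) (η : ℝ → S) (n : ℕ) :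
    survivalProd p0 π Q h η n ∈ Icc (0 : ℝ) 1 :=
  ⟨Finset.prod_nonneg fun k _ => (factor_mem_Icc hQ hπ hp0 hh k _).1,
    Finset.prod_le_one (fun k _ => (factor_mem_Icc hQ hπ hp0 hh k _).1)
      fun k _ => (factor_mem_Icc hQ hπ hp0 hh k _).2⟩

theorem survivalProd_antitone (hQ : IsIrreducibleGenerator Q) (hπ : IsStationary Q π)
    (hp0 : p0 ∈ stdSimplex ℝ S) {h : ℝ} (hh : 0 ≤ h) (η : ℝ → S) :
    Antitone (survivalProd p0 π Q h η) := by
  refine antitone_nat_of_succ_le fun n => ?_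
  rw [survivalProd, Finset.prod_range_succ]
  exact mul_le_of_le_one_right (survivalProd_mem_Icc hQ hπ hp0 hh η n).1
    (factor_mem_Icc hQ hπ hp0 hh _ _).2

theorem survivalProd_eq_zero {h : ℝ} {k n : ℕ} (hk : k ≤ n)
    (hgap : gap p0 π Q (k * h) (η (k * h)) ≤ 0) : survivalProd p0 π Q h η n = 0 :=
  Finset.prod_eq_zero (Finset.mem_range.2 (Nat.lt_succ_of_le hk)) (factor_eq_zero hgap)

/-- While the path sits at `y`, the transported excess is at least `exp (-(rate Q * h))` times the
current one, so the factors are bounded by successive ratios of excesses and telescope. The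
multiplied form avoids dividing by an excess that may vanish. -/
theorem survivalProd_mul_excess_le (hQ : IsIrreducibleGenerator Q) (hπ : IsStationary Q π)
    (hp0 : p0 ∈ stdSimplex ℝ S) {h : ℝ} (hh : 0 ≤ h) {j : ℕ} {y : S} (m : ℕ)
    (hy : ∀ k, j < k → k ≤ j + m → η (k * h) = y) :
    survivalProd p0 π Q h η (j + m) * excess p0 π Q (j * h) y ≤
      Real.exp (rate Q * h) ^ m * excess p0 π Q ((j + m : ℕ) * h) y := by
  induction m with
  | zero =>
    simpa using mul_le_of_le_one_left (excess_nonneg _ y) (survivalProd_mem_Icc hQ hπ hp0 hh η j).2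
  | succ m ih =>
    have ih' := ih fun k hk1 hk2 => hy k hk1 (hk2.trans (by omega))
    rw [← add_assoc]
    set A := survivalProd p0 π Q h η (j + m)
    set E := Real.exp (rate Q * h)
    set g := excess p0 π Q ((j + m : ℕ) * h) y
    have hstep : survivalProd p0 π Q h η (j + m + 1) =
        A * factor p0 π Q h (j + m + 1) y := by
      rw [survivalProd, Finset.prod_range_succ, hy (j + m + 1) (by omega) (by omega)]
      rfl
    have hf := factor_mem_Icc hQ hπ hp0 hh (j + m + 1) y
    have hE : 0 < E := Real.exp_pos _
    have hg : g ≤ E * (excess p0 π Q ((j + m : ℕ) * h) ᵥ* transition Q h) y := by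
      have h1 : g * Real.exp (-(rate Q * h)) ≤
          (excess p0 π Q ((j + m : ℕ) * h) ᵥ* transition Q h) y :=
        (mul_le_mul_of_nonneg_left (exp_neg_le_transition_self hQ.nonneg_off_diag hh y)
          (excess_nonneg _ y)).trans
          (Finset.single_le_sum (f := fun z =>
            excess p0 π Q ((j + m : ℕ) * h) z * transition Q h z y)
            (fun z _ => mul_nonneg (excess_nonneg _ z)
              (transition_nonneg hQ.nonneg_off_diag hh z y)) (Finset.mem_univ y))
      rw [Real.exp_neg, ← div_eq_mul_inv, div_le_iff₀ hE] at h1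
      linarith
    calc _ = A * excess p0 π Q (j * h) y * factor p0 π Q h (j + m + 1) y := by rw [hstep]; ring
      _ ≤ E ^ m * g * factor p0 π Q h (j + m + 1) y := mul_le_mul_of_nonneg_right ih' hf.1
      _ ≤ E ^ m * (E * (excess p0 π Q ((j + m : ℕ) * h) ᵥ* transition Q h) y) *
          factor p0 π Q h (j + m + 1) y := by gcongr; exact hf.1
      _ = E ^ (m + 1) * ((excess p0 π Q ((j + m : ℕ) * h) ᵥ* transition Q h) y *
          factor p0 π Q h (j + m + 1) y) := by ring
      _ = _ := by rw [vecMul_mul_factor hQ hπ hh]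

end Paths

/-! ### The survival product along a path that crosses -/

section Crossing

variable {S : Type*} [Fintype S] [DecidableEq S] {p0 π : S → ℝ} {Q : Matrix S S ℝ} {η : ℝ → S}

theorem eventually_natCeil_div {r b t : ℝ} (hr : 0 ≤ r) (hrb : r < b) (hbt : b ≤ t) :
    ∀ᶠ n : ℕ in atTop, ⌈r / (t / n)⌉₊ ≤ n ∧ (⌈r / (t / n)⌉₊ : ℝ) * (t / n) ∈ Ico r b := by
  have ht : 0 < t := hr.trans_lt (hrb.trans_le hbt)
  have h := (tendsto_natCeil_div_mul hr ht).eventually (Ico_mem_nhdsGE hrb)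
  filter_upwards [h, eventually_gt_atTop 0] with n hn hn0
  exact ⟨natCeil_div_le (hrb.le.trans hbt) ht hn0, hn⟩

theorem eventually_survivalProd_eq_zero {a b t : ℝ} (ha : 0 ≤ a) (hab : a < b) (hbt : b ≤ t)
    (h : ∀ u ∈ Ico a b, gap p0 π Q u (η u) ≤ 0) :
    ∀ᶠ n : ℕ in atTop, survivalProd p0 π Q (t / n) η n = 0 := by
  filter_upwards [eventually_natCeil_div ha hab hbt] with n hn
  exact survivalProd_eq_zero hn.1 (h _ hn.2)

/-- A contact at the single time `r` need not be seen by any grid point; the product still vanishes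
in the limit because the telescoped bound compares the excess near `r` with the excess at an earlier
time. -/
theorem tendsto_survivalProd_of_const (hQ : IsIrreducibleGenerator Q) (hπ : IsStationary Q π)
    (hp0 : p0 ∈ stdSimplex ℝ S) {a r b t : ℝ} {y : S} (ha : 0 ≤ a) (har : a < r) (hrb : r < b)
    (hbt : b ≤ t) (hη : ∀ u ∈ Ico a b, η u = y) (hr : gap p0 π Q r y ≤ 0) :
    Tendsto (fun n : ℕ => survivalProd p0 π Q (t / n) η n) atTop (𝓝 0) := by
  -- Either a whole interval of nonpositive gap catches a grid point and kills the product, or some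
  -- `u < r` has positive gap and serves as the starting point of the telescoped bound.
  by_cases hneg : ∀ u ∈ Ico a r, gap p0 π Q u y ≤ 0
  · refine tendsto_const_nhds.congr' ?_
    filter_upwards [eventually_survivalProd_eq_zero (p0 := p0) (π := π) (Q := Q) (η := η) ha har
      (hrb.le.trans hbt) fun u hu => by rw [hη u ⟨hu.1, hu.2.trans hrb⟩]; exact hneg u hu]
      with n hn using hn.symm
  push Not at hneg
  obtain ⟨u, hu, hupos⟩ := hneg
  have hu0 : 0 ≤ u := ha.trans hu.1
  have ht : 0 < t := by linarith [hu.2]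
  set j : ℕ → ℕ := fun n => ⌈u / (t / n)⌉₊ with hj
  set i : ℕ → ℕ := fun n => ⌈r / (t / n)⌉₊ with hi
  have hjlim : Tendsto (fun n : ℕ => excess p0 π Q (j n * (t / n)) y) atTop
      (𝓝 (excess p0 π Q u y)) :=
    ((continuous_excess y).tendsto u).comp
      (tendsto_nhds_of_tendsto_nhdsWithin (tendsto_natCeil_div_mul hu0 ht))
  have hilim : Tendsto (fun n : ℕ => excess p0 π Q (i n * (t / n)) y) atTop (𝓝 0) := by
    rw [← excess_eq_zero hr]
    exact ((continuous_excess y).tendsto r).comp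
      (tendsto_nhds_of_tendsto_nhdsWithin (tendsto_natCeil_div_mul (by linarith [hu.2]) ht))
  have hupos' : 0 < excess p0 π Q u y := by rwa [excess_eq_gap hupos.le]
  have hlim : Tendsto (fun n : ℕ => Real.exp (rate Q * t) *
      (excess p0 π Q (i n * (t / n)) y / excess p0 π Q (j n * (t / n)) y)) atTop (𝓝 0) := by
    simpa using (hilim.div hjlim hupos'.ne').const_mul (Real.exp (rate Q * t))
  refine squeeze_zero' (Eventually.of_forall fun n =>
    (survivalProd_mem_Icc hQ hπ hp0 (by positivity) η n).1) ?_ hlim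
  filter_upwards [eventually_natCeil_div hu0 hu.2 (hrb.le.trans hbt),
    eventually_natCeil_div (by linarith [hu.2]) hrb hbt, hjlim.eventually_const_lt hupos',
    eventually_gt_atTop 0] with n hjn hin hpos hn0
  have hn' : (0 : ℝ) < n := by exact_mod_cast hn0
  have hh : 0 < t / n := by positivity
  have hji : j n ≤ i n := by
    have : (j n : ℝ) * (t / n) < i n * (t / n) := hjn.2.2.trans_le hin.2.1
    have := lt_of_mul_lt_mul_right this hh.le
    exact_mod_cast this.le
  have key := survivalProd_mul_excess_le hQ hπ hp0 hh.le (η := η) (j := j n) (y := y)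
    (i n - j n) fun k hk1 hk2 => by
      refine hη _ ⟨hu.1.trans (hjn.2.1.trans ?_), lt_of_le_of_lt ?_ hin.2.2⟩
      · exact mul_le_mul_of_nonneg_right (by exact_mod_cast hk1.le) hh.le
      · refine mul_le_mul_of_nonneg_right ?_ hh.le
        have : k ≤ i n := by omega
        exact_mod_cast this
  rw [Nat.add_sub_cancel' hji] at key
  have hE : Real.exp (rate Q * (t / n)) ^ (i n - j n) ≤ Real.exp (rate Q * t) := by
    rw [← Real.exp_nat_mul]
    refine Real.exp_le_exp.2 ?_
    have h1 : ((i n - j n : ℕ) : ℝ) ≤ n := by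
      have : i n - j n ≤ n := (Nat.sub_le _ _).trans hin.1
      exact_mod_cast this
    calc ((i n - j n : ℕ) : ℝ) * (rate Q * (t / n)) ≤ n * (rate Q * (t / n)) :=
          mul_le_mul_of_nonneg_right h1 (mul_nonneg (rate_nonneg Q) hh.le)
      _ = rate Q * t := by field_simp
  have hanti := survivalProd_antitone hQ hπ hp0 hh.le η hin.1
  rw [← mul_div_assoc, le_div_iff₀ hpos]
  calc _ ≤ survivalProd p0 π Q (t / n) η (i n) * excess p0 π Q (j n * (t / n)) y :=
        mul_le_mul_of_nonneg_right hanti hpos.le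
    _ ≤ _ := key
    _ ≤ _ := mul_le_mul_of_nonneg_right hE (excess_nonneg _ y)

/-- The times `0` and `t` belong to the grid, so only an interior crossing needs care: it is reduced
to one strictly inside an interval where the path is constant. -/
theorem IsGoodPath.tendsto_survivalProd_of_crossing (hQ : IsIrreducibleGenerator Q)
    (hπ : IsStationary Q π) (hp0 : p0 ∈ stdSimplex ℝ S) (hη : IsGoodPath p0 π Q η) {t : ℝ}
    (h : ∃ s ∈ Icc 0 t, gap p0 π Q s (η s) ≤ 0) :
    Tendsto (fun n : ℕ => survivalProd p0 π Q (t / n) η n) atTop (𝓝 0) := by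
  obtain ⟨s, hs, hgap⟩ := h
  rcases hs.1.eq_or_lt with rfl | hs0
  · refine tendsto_const_nhds.congr fun n => ?_
    exact (survivalProd_eq_zero (Nat.zero_le n) (by simpa using hgap)).symm
  rcases hs.2.eq_or_lt with rfl | hst
  · refine tendsto_const_nhds.congr' ?_
    filter_upwards [eventually_gt_atTop 0] with n hn
    have hn' : (0 : ℝ) < n := by exact_mod_cast hn
    have e : (n : ℝ) * (s / n) = s := by field_simp
    exact (survivalProd_eq_zero le_rfl (by rwa [e])).symm
  obtain ⟨b, hb, hbη⟩ : ∃ b, s < b ∧ ∀ u ∈ Ico s b, η u = η s := by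
    obtain ⟨b, hb, hsub⟩ := (mem_nhdsGE_iff_exists_Ico_subset).1 (hη.eventually_ge s)
    exact ⟨b, hb, fun u hu => hsub hu⟩
  have hbt : s < min b t := lt_min hb hst
  have hconst : ∀ u ∈ Ico s (min b t), η u = η s := fun u hu =>
    hbη u ⟨hu.1, hu.2.trans_le (min_le_left _ _)⟩
  -- If `s` is isolated on the right it is exceptional, so the path does not jump and is constant
  -- around `s`. Otherwise the same state has another crossing time shortly after `s`, before the
  -- next jump.
  by_cases hiso : 𝓝[{r | gap p0 π Q r (η s) ≤ 0} ∩ Ioi s] s = ⊥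
  · have hex : s ∈ exceptionalTimes p0 π Q := mem_iUnion.2 ⟨η s, Or.inl ⟨hgap, hiso⟩⟩
    obtain ⟨a, ha, hsub⟩ := (mem_nhdsLT_iff_exists_Ioo_subset).1 (hη.no_jump s hex)
    obtain ⟨a', ha1, ha2⟩ := exists_between (max_lt ha hs0)
    refine tendsto_survivalProd_of_const hQ hπ hp0 (a := a') (r := s) (b := min b t) (y := η s)
      ((le_max_right _ _).trans ha1.le) ha2 hbt (min_le_right _ _) (fun u hu => ?_) hgap
    rcases lt_or_ge u s with hus | hus
    · exact hsub ⟨(le_max_left _ _).trans_lt (ha1.trans_le hu.1), hus⟩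
    · exact hconst u ⟨hus, hu.2⟩
  · have hne : (𝓝[{r | gap p0 π Q r (η s) ≤ 0} ∩ Ioi s] s).NeBot := ⟨hiso⟩
    have h1 : ∀ᶠ r in 𝓝[{r | gap p0 π Q r (η s) ≤ 0} ∩ Ioi s] s, r < min b t :=
      nhdsWithin_le_nhds (gt_mem_nhds hbt)
    obtain ⟨r, hr1, hr2, hr3⟩ := (h1.and self_mem_nhdsWithin).exists
    exact tendsto_survivalProd_of_const hQ hπ hp0 hs0.le hr3 hr1 (min_le_right _ _) hconst hr2

end Crossing

/-! ### The functional `J` and the stopping time -/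

section StoppingFunctional

variable {S : Type*} [Fintype S] [DecidableEq S] {p0 π : S → ℝ} {Q : Matrix S S ℝ}
  {Ω : Type*} {X : ℝ≥0 → Ω → S} {ω : Ω}

theorem J_of_crossing {t : ℝ≥0} (h : ∃ s ∈ Icc 0 (t : ℝ), gap p0 π Q s (X s.toNNReal ω) ≤ 0) :
    J p0 π Q X t ω = 0 := by
  obtain ⟨s, hs, hgap⟩ := h
  refine if_pos ⟨s.toNNReal, Real.toNNReal_le_iff_le_coe.2 hs.2, ?_⟩
  rw [Real.coe_toNNReal _ hs.1]
  exact sub_nonpos.1 hgap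

theorem J_of_pos {t : ℝ≥0} (h : ∀ s ∈ Icc 0 (t : ℝ), 0 < gap p0 π Q s (X s.toNNReal ω)) :
    J p0 π Q X t ω = (1 - psi0 p0 π (X 0 ω)) * Real.exp (∫ s in (0 : ℝ)..t,
      minFlow p0 π Q s (X s.toNNReal ω) / gap p0 π Q s (X s.toNNReal ω)) := by
  refine if_neg ?_
  rintro ⟨s, hs, hle⟩
  have := h s ⟨s.2, hs⟩
  rw [Real.toNNReal_coe] at this
  exact absurd (sub_pos.1 this) (not_lt.2 hle)

theorem crossing_or_pos (p0 π : S → ℝ) (Q : Matrix S S ℝ) (η : ℝ → S) (t : ℝ) :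
    (∃ s ∈ Icc 0 t, gap p0 π Q s (η s) ≤ 0) ∨ ∀ s ∈ Icc 0 t, 0 < gap p0 π Q s (η s) := by
  by_cases h : ∃ s ∈ Icc 0 t, gap p0 π Q s (η s) ≤ 0
  · exact Or.inl h
  · push Not at h
    exact Or.inr h

theorem tendsto_survivalProd_J (hQ : IsIrreducibleGenerator Q) (hπ : IsStationary Q π)
    (hp0 : p0 ∈ stdSimplex ℝ S) (hη : IsGoodPath p0 π Q fun s => X s.toNNReal ω) (t : ℝ≥0) :
    Tendsto (fun n : ℕ => survivalProd p0 π Q (t / n) (fun s => X s.toNNReal ω) n) atTop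
      (𝓝 (J p0 π Q X t ω)) := by
  rcases crossing_or_pos p0 π Q (fun s => X s.toNNReal ω) t with h | h
  · rw [J_of_crossing h]
    exact hη.tendsto_survivalProd_of_crossing hQ hπ hp0 h
  · rw [J_of_pos h]
    simpa using hη.tendsto_survivalProd_of_pos hQ hπ hp0 t.coe_nonneg h

theorem J_mem_Icc (hQ : IsIrreducibleGenerator Q) (hπ : IsStationary Q π)
    (hp0 : p0 ∈ stdSimplex ℝ S) (hη : IsGoodPath p0 π Q fun s => X s.toNNReal ω) (t : ℝ≥0) :
    J p0 π Q X t ω ∈ Icc (0 : ℝ) 1 :=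
  isClosed_Icc.mem_of_tendsto (tendsto_survivalProd_J hQ hπ hp0 hη t)
    (Eventually.of_forall fun n => survivalProd_mem_Icc hQ hπ hp0 (by positivity) _ n)

theorem J_antitone (hQ : IsIrreducibleGenerator Q) (hπ : IsStationary Q π)
    (hp0 : p0 ∈ stdSimplex ℝ S) (hη : IsGoodPath p0 π Q fun s => X s.toNNReal ω) :
    Antitone fun t => J p0 π Q X t ω := by
  intro s t hst
  have hst' : (s : ℝ) ≤ t := hst
  simp only
  rcases crossing_or_pos p0 π Q (fun s => X s.toNNReal ω) t with h | h
  · rw [J_of_crossing h]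
    exact (J_mem_Icc hQ hπ hp0 hη s).1
  have hs : ∀ r ∈ Icc 0 (s : ℝ), 0 < gap p0 π Q r (X r.toNNReal ω) := fun r hr =>
    h r ⟨hr.1, hr.2.trans hst'⟩
  rw [J_of_pos h, J_of_pos hs]
  refine mul_le_mul_of_nonneg_left (Real.exp_le_exp.2 ?_)
    (sub_nonneg.2 (psi0_mem_Icc hp0 hπ.prob.1 _).2)
  have hint := (hη.tendsto_riemann_potential hQ hπ hp0 t.coe_nonneg h).1
  have hint1 := (hη.tendsto_riemann_potential hQ hπ hp0 s.coe_nonneg hs).1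
  rw [← intervalIntegral.integral_add_adjacent_intervals hint1 (hint1.symm.trans hint)]
  refine add_le_of_nonpos_right ?_
  rw [← neg_nonneg, ← intervalIntegral.integral_neg]
  refine intervalIntegral.integral_nonneg hst' fun r hr => neg_nonneg.2 ?_
  have hr' := h r ⟨s.coe_nonneg.trans hr.1, hr.2⟩
  exact div_nonpos_of_nonpos_of_nonneg (minFlow_nonpos hQ hπ hr'.le) hr'.le

/-- If `J_t > 0` there is no crossing up to `t`, nor shortly after by right-continuity, and there
`J` is a continuous function of time. -/
theorem eventually_lt_J (hQ : IsIrreducibleGenerator Q) (hπ : IsStationary Q π)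
    (hp0 : p0 ∈ stdSimplex ℝ S) (hη : IsGoodPath p0 π Q fun s => X s.toNNReal ω) {t : ℝ≥0}
    {u : ℝ} (hu : 0 ≤ u) (hut : u < J p0 π Q X t ω) :
    ∃ r, t < r ∧ u < J p0 π Q X r ω := by
  rcases crossing_or_pos p0 π Q (fun s => X s.toNNReal ω) t with h | h
  · rw [J_of_crossing h] at hut
    exact absurd hu (not_le.2 hut)
  obtain ⟨b, hb, hpos⟩ : ∃ b : ℝ, (t : ℝ) < b ∧
      ∀ s ∈ Icc 0 b, 0 < gap p0 π Q s (X s.toNNReal ω) := by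
    have hgt := h t ⟨t.coe_nonneg, le_rfl⟩
    have h1 : ∀ᶠ r in 𝓝[≥] (t : ℝ), 0 < gap p0 π Q r (X r.toNNReal ω) := by
      filter_upwards [hη.eventually_ge t, nhdsWithin_le_nhds
        ((continuous_gap (X (t : ℝ).toNNReal ω)).continuousAt.eventually_const_lt hgt)]
        with r hr hr2
      rw [hr]
      exact hr2
    obtain ⟨b, hb, hsub⟩ := (mem_nhdsGE_iff_exists_Icc_subset).1 h1
    refine ⟨b, hb, fun s hs => ?_⟩
    rcases le_total s t with hst | hst
    · exact h s ⟨hs.1, hst⟩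
    · exact hsub ⟨hst, hs.2⟩
  have hb0 : 0 ≤ b := t.coe_nonneg.trans hb.le
  have hint := (hη.tendsto_riemann_potential hQ hπ hp0 hb0 hpos).1
  set V : ℝ → ℝ := fun s =>
    minFlow p0 π Q s (X s.toNNReal ω) / gap p0 π Q s (X s.toNNReal ω) with hV
  have hcont : ContinuousOn (fun r => (1 - psi0 p0 π (X 0 ω)) *
      Real.exp (∫ s in (0 : ℝ)..r, V s)) (Icc 0 b) := by
    refine continuousOn_const.mul (Real.continuous_exp.comp_continuousOn ?_)
    rw [← uIcc_of_le hb0]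
    refine intervalIntegral.continuousOn_primitive_interval' hint left_mem_uIcc
  have hev : ∀ᶠ r in 𝓝[>] (t : ℝ), u < (1 - psi0 p0 π (X 0 ω)) *
      Real.exp (∫ s in (0 : ℝ)..r, V s) := by
    have hc := (hcont t ⟨t.coe_nonneg, hb.le⟩).tendsto
    rw [J_of_pos h] at hut
    have := hc.eventually_const_lt hut
    have hsub : Ioo (t : ℝ) b ⊆ Icc 0 b := fun r hr => ⟨t.coe_nonneg.trans hr.1.le, hr.2.le⟩
    exact nhdsWithin_le_of_mem (mem_of_superset (Ioo_mem_nhdsGT hb) hsub) this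
  have hnear : ∀ᶠ r in 𝓝[>] (t : ℝ), r ∈ Ioo (t : ℝ) b := Ioo_mem_nhdsGT hb
  obtain ⟨r, hr1, hr3⟩ := (hev.and hnear).exists
  have hr0 : 0 ≤ r := t.coe_nonneg.trans hr3.1.le
  refine ⟨⟨r, hr0⟩, hr3.1, ?_⟩
  have hposr : ∀ s ∈ Icc 0 ((⟨r, hr0⟩ : ℝ≥0) : ℝ), 0 < gap p0 π Q s (X s.toNNReal ω) :=
    fun s hs => hpos s ⟨hs.1, le_trans hs.2 hr3.2.le⟩
  rw [J_of_pos hposr]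
  exact hr1

/-- As `J` is nonincreasing, `{t | J_t ≤ U}` is an up-set; `eventually_lt_J` gives the strict
inequality when `U < J_t`. -/
theorem lt_stopTime_iff (hQ : IsIrreducibleGenerator Q) (hπ : IsStationary Q π)
    (hp0 : p0 ∈ stdSimplex ℝ S) (hη : IsGoodPath p0 π Q fun s => X s.toNNReal ω) {U : Ω → ℝ}
    (hU : 0 ≤ U ω) (t : ℝ≥0) :
    (t : ℝ≥0∞) < stopTime p0 π Q X U ω ↔ U ω < J p0 π Q X t ω := by
  constructor
  · intro h
    by_contra hle
    have hT : stopTime p0 π Q X U ω ≤ t := by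
      unfold stopTime
      exact iInf₂_le (f := fun (s : ℝ≥0) (_ : J p0 π Q X s ω ≤ U ω) => (s : ℝ≥0∞)) t (not_lt.1 hle)
    exact absurd h (not_lt.2 hT)
  · intro h
    obtain ⟨r, htr, hr⟩ := eventually_lt_J hQ hπ hp0 hη hU h
    refine lt_of_lt_of_le (ENNReal.coe_lt_coe.2 htr) (le_iInf₂ fun s hs => ?_)
    rw [ENNReal.coe_le_coe]
    by_contra hlt
    exact absurd (hr.trans_le (J_antitone hQ hπ hp0 hη (not_le.1 hlt).le)) (not_lt.2 hs)

end StoppingFunctional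

/-! ### The Markov property and the expected survival product -/

section MarkovProperty

variable {S : Type*} [Fintype S] [DecidableEq S] [MeasurableSpace S] [MeasurableSingletonClass S]
  {Ω : Type*} [MeasurableSpace Ω] {P : Measure Ω} [IsProbabilityMeasure P]
  {p0 π : S → ℝ} {Q : Matrix S S ℝ} {X : ℝ≥0 → Ω → S}

theorem IsMarkovChain.measureReal_snoc (hX : IsMarkovChain P X p0 Q) {n : ℕ}
    {t : Fin (n + 1) → ℝ≥0} (ht : Monotone t) (h0 : t 0 = 0) {s : ℝ≥0} (hs : t (Fin.last n) ≤ s)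
    (x : Fin (n + 1) → S) (y : S) :
    P.real {ω | (∀ i, X (t i) ω = x i) ∧ X s ω = y} =
      P.real {ω | ∀ i, X (t i) ω = x i} *
        transition Q ((s : ℝ) - t (Fin.last n)) (x (Fin.last n)) y := by
  have hmono : Monotone (Fin.snoc t s : Fin (n + 1 + 1) → ℝ≥0) := by
    refine Fin.monotone_iff_le_succ.2 fun i => ?_
    induction i using Fin.lastCases with
    | last => rw [Fin.snoc_castSucc, Fin.succ_last, Fin.snoc_last]; exact hs
    | cast i =>
      rw [Fin.snoc_castSucc, Fin.succ_castSucc, Fin.snoc_castSucc]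
      exact ht (Fin.castSucc_le_succ i)
  have hz : (Fin.snoc t s : Fin (n + 1 + 1) → ℝ≥0) 0 = 0 := by
    rw [← Fin.castSucc_zero, Fin.snoc_castSucc, h0]
  have h1 := hX.fdd (n + 1) (Fin.snoc t s) hmono hz (Fin.snoc x y)
  rw [hX.fdd n t ht h0 x]
  have e : {ω | ∀ i, X ((Fin.snoc t s : Fin (n + 1 + 1) → ℝ≥0) i) ω =
      (Fin.snoc x y : Fin (n + 1 + 1) → S) i} = {ω | (∀ i, X (t i) ω = x i) ∧ X s ω = y} := by
    ext ω
    simp [Fin.forall_fin_succ']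
  rw [e] at h1
  rw [h1, Fin.prod_univ_castSucc, ← mul_assoc]
  congr 1
  · congr 1
    refine Finset.prod_congr rfl fun i _ => ?_
    rw [Fin.snoc_castSucc, Fin.snoc_castSucc, Fin.succ_castSucc, Fin.snoc_castSucc,
      Fin.snoc_castSucc]
  · rw [Fin.snoc_castSucc, Fin.snoc_castSucc, Fin.succ_last, Fin.snoc_last, Fin.snoc_last]

theorem setIntegral_comp_eq_sum {α : Type*} [Fintype α] [MeasurableSpace α]
    [MeasurableSingletonClass α] {Y : Ω → α} (hY : Measurable Y) (F : α → ℝ) (B : Set Ω) :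
    ∫ ω in B, F (Y ω) ∂P = ∑ a, F a * P.real ({ω | Y ω = a} ∩ B) := by
  rw [← integral_map (φ := Y) (f := F) hY.aemeasurable (Measurable.of_discrete.aestronglyMeasurable),
    integral_fintype .of_finite]
  refine Finset.sum_congr rfl fun a _ => ?_
  rw [smul_eq_mul, mul_comm, map_measureReal_apply hY (measurableSet_singleton a),
    measureReal_restrict_apply (hY (measurableSet_singleton a))]
  rfl

/-- The Markov property for functionals of finitely many times, obtained by summing the
finite-dimensional distributions over all trajectories. -/
theorem IsMarkovChain.setIntegral_mul_transition (hX : IsMarkovChain P X p0 Q) {n : ℕ}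
    {t : Fin (n + 1) → ℝ≥0} (ht : Monotone t) (h0 : t 0 = 0) {s : ℝ≥0} (hs : t (Fin.last n) ≤ s)
    (F : (Fin (n + 1) → S) → ℝ) (z y : S) :
    ∫ ω in {ω | X (t (Fin.last n)) ω = z ∧ X s ω = y}, F (fun i => X (t i) ω) ∂P =
      (∫ ω in {ω | X (t (Fin.last n)) ω = z}, F (fun i => X (t i) ω) ∂P) *
        transition Q ((s : ℝ) - t (Fin.last n)) z y := by
  have hY : Measurable fun ω i => X (t i) ω := measurable_pi_lambda _ fun i => hX.measurable _
  rw [setIntegral_comp_eq_sum hY, setIntegral_comp_eq_sum hY, Finset.sum_mul]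
  refine Finset.sum_congr rfl fun x _ => ?_
  rw [mul_assoc]
  congr 1
  by_cases hx : x (Fin.last n) = z
  · have e1 : {ω | (fun i => X (t i) ω) = x} ∩ {ω | X (t (Fin.last n)) ω = z ∧ X s ω = y} =
        {ω | (∀ i, X (t i) ω = x i) ∧ X s ω = y} := by
      ext ω
      simp only [mem_inter_iff, mem_ofPred_eq, funext_iff]
      exact ⟨fun h => ⟨h.1, h.2.2⟩, fun h => ⟨h.1, (h.1 _).trans hx, h.2⟩⟩
    have e2 : {ω | (fun i => X (t i) ω) = x} ∩ {ω | X (t (Fin.last n)) ω = z} =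
        {ω | ∀ i, X (t i) ω = x i} := by
      ext ω
      simp only [mem_inter_iff, mem_ofPred_eq, funext_iff]
      exact ⟨fun h => h.1, fun h => ⟨h, (h _).trans hx⟩⟩
    rw [e1, e2, hX.measureReal_snoc ht h0 hs, hx]
  · have e : ∀ B : Set Ω, B ⊆ {ω | X (t (Fin.last n)) ω = z} →
        P.real ({ω | (fun i => X (t i) ω) = x} ∩ B) = 0 := by
      intro B hB
      convert measureReal_empty
      refine eq_empty_of_forall_notMem fun ω hω => hx ?_
      exact (congrFun hω.1 _).symm.trans (hB hω.2)
    rw [e _ fun ω hω => hω.1, e _ subset_rfl, zero_mul]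

theorem IsMarkovChain.measureReal_zero (hX : IsMarkovChain P X p0 Q) (z : S) :
    P.real {ω | X 0 ω = z} = p0 z := by
  have := hX.fdd 0 (fun _ => 0) monotone_const rfl fun _ => z
  simpa using this

theorem measureReal_eq_sum_fiber {Y : Ω → S} (hY : Measurable Y) (A : Set Ω) :
    P.real A = ∑ z, P.real (A ∩ {ω | Y ω = z}) := by
  have := measureReal_restrict_apply_univ (μ := P) A
  have h2 := setIntegral_comp_eq_sum (P := P) hY (fun _ => (1 : ℝ)) A
  simp only [integral_const, measureReal_restrict_apply_univ, smul_eq_mul, mul_one, one_mul] at h2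
  rw [h2]
  exact Finset.sum_congr rfl fun z _ => by rw [inter_comm]

theorem IsMarkovChain.measureReal_marg (hX : IsMarkovChain P X p0 Q) (s : ℝ≥0) (x : S) :
    P.real {ω | X s ω = x} = marg p0 Q s x := by
  rw [measureReal_eq_sum_fiber (hX.measurable 0)]
  refine Finset.sum_congr rfl fun z _ => ?_
  have h := hX.setIntegral_mul_transition (n := 0) (t := fun _ => 0) monotone_const rfl
    (zero_le) (s := s) (fun _ => 1) z x
  simp only [integral_const, measureReal_restrict_apply_univ, smul_eq_mul, mul_one,
    hX.measureReal_zero, NNReal.coe_zero, sub_zero] at h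
  rw [← h]
  congr 1
  ext ω
  exact and_comm

theorem IsMarkovChain.measureReal_pair (hX : IsMarkovChain P X p0 Q) {s t : ℝ≥0} (hst : s ≤ t)
    (z x : S) : P.real {ω | X s ω = z ∧ X t ω = x} =
      marg p0 Q s z * transition Q ((t : ℝ) - s) z x := by
  have h := hX.setIntegral_mul_transition (n := 1) (t := ![0, s])
    (by intro i j hij; fin_cases i <;> fin_cases j <;> simp_all) rfl
    (s := t) (by simpa using hst) (fun _ => 1) z x
  simpa [integral_const, hX.measureReal_marg] using h

/-- The survival product on the path of the chain. -/
noncomputable def chainProd (p0 π : S → ℝ) (Q : Matrix S S ℝ) (X : ℝ≥0 → Ω → S) (h : ℝ≥0) (n : ℕ)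
    (ω : Ω) : ℝ :=
  ∏ k ∈ Finset.range (n + 1), factor p0 π Q h k (X (k * h) ω)

theorem monotone_grid (h : ℝ≥0) (n : ℕ) : Monotone fun i : Fin (n + 1) => (i : ℕ) * h := by
  intro i j hij
  simp only
  gcongr
  exact hij

theorem IsMarkovChain.setIntegral_chainProd_pair (hX : IsMarkovChain P X p0 Q) (h : ℝ≥0) (n : ℕ)
    {s : ℝ≥0} (hs : n * h ≤ s) (z y : S) :
    ∫ ω in {ω | X (n * h) ω = z ∧ X s ω = y}, chainProd p0 π Q X h n ω ∂P =
      (∫ ω in {ω | X (n * h) ω = z}, chainProd p0 π Q X h n ω ∂P) *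
        transition Q ((s : ℝ) - n * h) z y := by
  have := hX.setIntegral_mul_transition (n := n) (t := fun i : Fin (n + 1) => (i : ℕ) * h)
    (monotone_grid h n) (by simp) (by simpa using hs)
    (fun x => ∏ i : Fin (n + 1), factor p0 π Q h i (x i)) z y
  simpa [chainProd, Finset.prod_range] using this

theorem measurable_chainProd (hX : IsMarkovChain P X p0 Q) (h : ℝ≥0) (n : ℕ) :
    Measurable (chainProd p0 π Q X h n) :=
  Finset.measurable_fun_prod _ fun k _ =>
    (Measurable.of_discrete (f := factor p0 π Q h k)).comp (hX.measurable _)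

theorem chainProd_mem_Icc (hQ : IsIrreducibleGenerator Q) (hπ : IsStationary Q π)
    (hp0 : p0 ∈ stdSimplex ℝ S) (h : ℝ≥0) (n : ℕ) (ω : Ω) :
    chainProd p0 π Q X h n ω ∈ Icc (0 : ℝ) 1 :=
  ⟨Finset.prod_nonneg fun k _ => (factor_mem_Icc hQ hπ hp0 h.coe_nonneg k _).1,
    Finset.prod_le_one (fun k _ => (factor_mem_Icc hQ hπ hp0 h.coe_nonneg k _).1)
      fun k _ => (factor_mem_Icc hQ hπ hp0 h.coe_nonneg k _).2⟩

theorem integrable_chainProd (hQ : IsIrreducibleGenerator Q) (hπ : IsStationary Q π)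
    (hp0 : p0 ∈ stdSimplex ℝ S) (hX : IsMarkovChain P X p0 Q) (h : ℝ≥0) (n : ℕ) :
    Integrable (chainProd p0 π Q X h n) P := by
  refine .of_bound (measurable_chainProd hX h n).aestronglyMeasurable 1 (ae_of_all _ fun ω => ?_)
  have := chainProd_mem_Icc (X := X) hQ hπ hp0 h n ω
  rw [Real.norm_eq_abs, abs_of_nonneg this.1]
  exact this.2

/-- Induction on the number of steps: the Markov property transports the excess by one step, and the
next factor turns the result into the new excess. No approximation is involved. -/
theorem IsMarkovChain.setIntegral_chainProd (hQ : IsIrreducibleGenerator Q)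
    (hπ : IsStationary Q π) (hp0 : p0 ∈ stdSimplex ℝ S) (hX : IsMarkovChain P X p0 Q) (h : ℝ≥0)
    (n : ℕ) (y : S) :
    ∫ ω in {ω | X (n * h) ω = y}, chainProd p0 π Q X h n ω ∂P = excess p0 π Q (n * h) y := by
  have hms : ∀ (t : ℝ≥0) (y : S), MeasurableSet {ω | X t ω = y} := fun t y =>
    hX.measurable t (measurableSet_singleton y)
  induction n generalizing y with
  | zero =>
    have : ∀ ω ∈ {ω | X ((0 : ℕ) * h) ω = y}, chainProd p0 π Q X h 0 ω = 1 - psi0 p0 π y := by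
      intro ω hω
      simp only [chainProd, zero_add, Finset.prod_range_one, factor]
      rw [hω]
    rw [setIntegral_congr_fun (hms _ y) this, setIntegral_const]
    simp only [Nat.cast_zero, zero_mul, smul_eq_mul]
    rw [hX.measureReal_zero, mul_one_sub_psi0 hπ.prob.1]
  | succ n ih =>
    have h1 : ∀ ω ∈ {ω | X ((n + 1 : ℕ) * h) ω = y}, chainProd p0 π Q X h (n + 1) ω =
        chainProd p0 π Q X h n ω * factor p0 π Q h (n + 1) y := by
      intro ω hω
      rw [chainProd, Finset.prod_range_succ, chainProd]
      rw [show X ((n + 1 : ℕ) * h) ω = y from hω]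
    rw [setIntegral_congr_fun (hms _ y) h1, integral_mul_const]
    have hle : n * h ≤ ((n + 1 : ℕ) : ℝ≥0) * h := by gcongr; exact Nat.le_succ n
    have h2 : ∫ ω in {ω | X ((n + 1 : ℕ) * h) ω = y}, chainProd p0 π Q X h n ω ∂P =
        ∑ z, ∫ ω in {ω | X (n * h) ω = z ∧ X ((n + 1 : ℕ) * h) ω = y},
          chainProd p0 π Q X h n ω ∂P := by
      rw [← integral_iUnion_fintype]
      · congr 2
        ext ω
        simp
      · exact fun z => (hms _ z).inter (hms _ y)
      · intro z w hzw
        refine Set.disjoint_left.2 fun ω h1 h2 => hzw (h1.1.symm.trans h2.1)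
      · exact fun z => (integrable_chainProd hQ hπ hp0 hX h n).integrableOn
    rw [h2, ← vecMul_mul_factor hQ hπ h.coe_nonneg]
    congr 1
    refine Finset.sum_congr rfl fun z _ => ?_
    rw [hX.setIntegral_chainProd_pair h n hle, ih]
    congr 2
    push_cast
    ring

end MarkovProperty

/-! ### Comparison with an independent uniform variable -/

section UniformThreshold

variable {Ω : Type*} [MeasurableSpace Ω] {P : Measure Ω} [IsProbabilityMeasure P]

theorem measureReal_lt_eq_integral {U W : Ω → ℝ} (hU : Measurable U)
    (hUlaw : P.map U = volume.restrict (Icc (0 : ℝ) 1)) (hW : Measurable W)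
    (hW1 : ∀ᵐ ω ∂P, W ω ∈ Icc (0 : ℝ) 1) (hUW : IndepFun U W P) :
    P.real {ω | U ω < W ω} = ∫ ω, W ω ∂P := by
  have hlt : MeasurableSet {z : ℝ × ℝ | z.1 < z.2} := measurableSet_lt measurable_fst measurable_snd
  have hmap := (indepFun_iff_map_prod_eq_prod_map_map hU.aemeasurable hW.aemeasurable).1 hUW
  have hprobU : IsProbabilityMeasure (P.map U) := Measure.isProbabilityMeasure_map hU.aemeasurable
  have hprobW : IsProbabilityMeasure (P.map W) := Measure.isProbabilityMeasure_map hW.aemeasurable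
  have h1 : P {ω | U ω < W ω} = ∫⁻ ω, ENNReal.ofReal (W ω) ∂P := by
    calc P {ω | U ω < W ω} = P.map (fun ω => (U ω, W ω)) {z : ℝ × ℝ | z.1 < z.2} :=
          (Measure.map_apply (hU.prodMk hW) hlt).symm
      _ = ∫⁻ w, P.map U {u | u < w} ∂(P.map W) := by
          rw [hmap, Measure.prod_apply_symm hlt]; rfl
      _ = ∫⁻ ω, P.map U {u | u < W ω} ∂P :=
          lintegral_map (measurable_measure_prodMk_right hlt) hW
      _ = ∫⁻ ω, ENNReal.ofReal (W ω) ∂P := by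
          refine lintegral_congr_ae ?_
          filter_upwards [hW1] with ω hω
          rw [hUlaw, Measure.restrict_apply (t := {u | u < W ω}) measurableSet_Iio]
          have : {u | u < W ω} ∩ Icc 0 1 = Ico 0 (W ω) := by
            ext u
            simp only [mem_inter_iff, mem_ofPred_eq, mem_Icc, mem_Ico]
            exact ⟨fun h => ⟨h.2.1, h.1⟩, fun h => ⟨h.2, h.1, h.2.le.trans hω.2⟩⟩
          rw [this, Real.volume_Ico, sub_zero]
  rw [measureReal_def, h1, integral_eq_lintegral_of_nonneg_ae (hW1.mono fun ω h => h.1)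
    hW.aestronglyMeasurable]

theorem ae_mem_Icc_of_uniform {U : Ω → ℝ} (hU : Measurable U)
    (hUlaw : P.map U = volume.restrict (Icc (0 : ℝ) 1)) : ∀ᵐ ω ∂P, U ω ∈ Icc (0 : ℝ) 1 := by
  refine ae_of_ae_map hU.aemeasurable (p := fun u => u ∈ Icc (0 : ℝ) 1) ?_
  rw [hUlaw]
  exact ae_restrict_mem measurableSet_Icc

end UniformThreshold

/-! ### Almost sure path properties and survival probabilities -/

section AlmostSurePaths

variable {S : Type*} [Fintype S] [DecidableEq S] [MeasurableSpace S] [MeasurableSingletonClass S]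
  {Ω : Type*} [MeasurableSpace Ω] {P : Measure Ω} [IsProbabilityMeasure P]
  {p0 π : S → ℝ} {Q : Matrix S S ℝ} {X : ℝ≥0 → Ω → S}

theorem IsMarkovChain.measureReal_ne_le (hQ : IsIrreducibleGenerator Q)
    (hp0 : p0 ∈ stdSimplex ℝ S) (hX : IsMarkovChain P X p0 Q) {s t : ℝ≥0} (hst : s ≤ t) :
    P.real {ω | X s ω ≠ X t ω} ≤ 1 - Real.exp (-(rate Q * ((t : ℝ) - s))) := by
  have hts : 0 ≤ (t : ℝ) - s := sub_nonneg.2 hst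
  have hmeas : MeasurableSet {ω | X s ω = X t ω} :=
    ((hX.measurable s).prodMk (hX.measurable t))
      (MeasurableSet.of_discrete (s := {z : S × S | z.1 = z.2}))
  have e : {ω | X s ω ≠ X t ω} = {ω | X s ω = X t ω}ᶜ := rfl
  rw [e, probReal_compl_eq_one_sub hmeas, measureReal_eq_sum_fiber (hX.measurable s)]
  refine sub_le_sub_left ?_ 1
  calc Real.exp (-(rate Q * ((t : ℝ) - s)))
      = ∑ z, marg p0 Q s z * Real.exp (-(rate Q * ((t : ℝ) - s))) := by
        rw [← Finset.sum_mul, sum_marg hQ hp0, one_mul]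
    _ ≤ _ := by
        refine Finset.sum_le_sum fun z _ => ?_
        have e2 : {ω | X s ω = X t ω} ∩ {ω | X s ω = z} = {ω | X s ω = z ∧ X t ω = z} := by
          ext ω
          simp only [mem_inter_iff, mem_ofPred_eq]
          exact ⟨fun h => ⟨h.2, h.1.symm.trans h.2⟩, fun h => ⟨h.1.trans h.2.symm, h.1⟩⟩
        rw [e2, hX.measureReal_pair hst]
        exact mul_le_mul_of_nonneg_left
          (exp_neg_le_transition_self hQ.nonneg_off_diag hts z) (marg_nonneg hQ hp0 s.coe_nonneg z)

/-- A jump at the fixed time `t` would make `X (u n) ≠ X t` for all late `n` along a sequence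
increasing to `t`, but these events have probability tending to zero. -/
theorem IsMarkovChain.ae_left_continuous (hQ : IsIrreducibleGenerator Q)
    (hp0 : p0 ∈ stdSimplex ℝ S) (hX : IsMarkovChain P X p0 Q) {t : ℝ≥0} (ht : 0 < t) :
    ∀ᵐ ω ∂P, ∀ᶠ s in 𝓝[<] t, X s ω = X t ω := by
  obtain ⟨u, -, hut, hulim⟩ := exists_seq_strictMono_tendsto' ht
  have hu : Tendsto u atTop (𝓝[<] t) := tendsto_nhdsWithin_iff.2
    ⟨hulim, Eventually.of_forall fun n => (hut n).2⟩
  have hbound : Tendsto (fun n => 1 - Real.exp (-(rate Q * ((t : ℝ) - u n)))) atTop (𝓝 0) := by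
    have hc : Continuous fun s : ℝ≥0 => 1 - Real.exp (-(rate Q * ((t : ℝ) - s))) := by fun_prop
    have := (hc.tendsto t).comp hulim
    simpa [Function.comp_def] using this
  have hnull : ∀ N : ℕ, ∀ᵐ ω ∂P, ¬ ∀ n ≥ N, X (u n) ω ≠ X t ω := by
    intro N
    rw [ae_iff]
    simp only [not_not]
    have h0 : P.real {ω | ∀ n ≥ N, X (u n) ω ≠ X t ω} ≤ 0 := by
      refine ge_of_tendsto hbound ?_
      filter_upwards [eventually_ge_atTop N] with n hn
      refine le_trans (measureReal_mono fun ω hω => ?_)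
        (hX.measureReal_ne_le hQ hp0 (hut n).2.le)
      exact hω n hn
    exact (measureReal_eq_zero_iff (measure_ne_top _ _)).1 (le_antisymm h0 measureReal_nonneg)
  filter_upwards [ae_all_iff.2 hnull, hX.leftLim] with ω hω hlim
  obtain ⟨x, hx⟩ := hlim t
  obtain ⟨N, hN⟩ := eventually_atTop.1 (hu.eventually hx)
  have := hω N
  push Not at this
  obtain ⟨n, hn, hne⟩ := this
  filter_upwards [hx] with s hs
  rw [hs, ← hne, hN n hn]

/-- Countably many exceptional times cost countably many null sets. At times `t ≤ 0` the path
extended through `Real.toNNReal` is constant to the left. -/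
theorem IsMarkovChain.ae_isGoodPath (hQ : IsIrreducibleGenerator Q)
    (hp0 : p0 ∈ stdSimplex ℝ S) (hX : IsMarkovChain P X p0 Q) (π : S → ℝ) :
    ∀ᵐ ω ∂P, IsGoodPath p0 π Q fun s => X s.toNNReal ω := by
  have hexc : ∀ᵐ ω ∂P, ∀ t ∈ exceptionalTimes p0 π Q, 0 < t →
      ∀ᶠ s in 𝓝[<] t.toNNReal, X s ω = X t.toNNReal ω := by
    rw [ae_ball_iff countable_exceptionalTimes]
    intro t _
    by_cases h : 0 < t
    · filter_upwards [hX.ae_left_continuous hQ hp0 (Real.toNNReal_pos.2 h)] with ω hω _ using hω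
    · exact ae_of_all _ fun ω h' => absurd h' h
  have hgt : ∀ t : ℝ, 0 ≤ t → Tendsto Real.toNNReal (𝓝[>] t) (𝓝[>] t.toNNReal) := by
    intro t ht
    refine tendsto_nhdsWithin_iff.2
      ⟨(continuous_real_toNNReal.tendsto t).mono_left nhdsWithin_le_nhds, ?_⟩
    filter_upwards [self_mem_nhdsWithin] with s hs
    exact (Real.toNNReal_lt_toNNReal_iff (ht.trans_lt hs)).2 hs
  have hlt : ∀ t : ℝ, 0 < t → Tendsto Real.toNNReal (𝓝[<] t) (𝓝[<] t.toNNReal) := by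
    intro t ht
    refine tendsto_nhdsWithin_iff.2
      ⟨(continuous_real_toNNReal.tendsto t).mono_left nhdsWithin_le_nhds, ?_⟩
    filter_upwards [self_mem_nhdsWithin] with s hs
    exact (Real.toNNReal_lt_toNNReal_iff ht).2 hs
  have hneg : ∀ (ω : Ω) (t : ℝ), t ≤ 0 →
      ∀ᶠ s in 𝓝[<] t, X s.toNNReal ω = X t.toNNReal ω := by
    intro ω t ht
    filter_upwards [self_mem_nhdsWithin] with s hs
    rw [Real.toNNReal_of_nonpos ht, Real.toNNReal_of_nonpos (le_trans (le_of_lt hs) ht)]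
  filter_upwards [hexc, hX.rightCts, hX.leftLim] with ω hω hr hl
  refine ⟨fun t => ?_, fun t => ?_, fun t ht => ?_⟩
  · rcases le_or_gt 0 t with ht | ht
    · exact (hgt t ht).eventually (hr t.toNNReal)
    · filter_upwards [nhdsWithin_le_nhds (gt_mem_nhds ht)] with s hs
      rw [Real.toNNReal_of_nonpos ht.le, Real.toNNReal_of_nonpos (le_of_lt hs)]
  · rcases lt_or_ge 0 t with ht | ht
    · obtain ⟨x, hx⟩ := hl t.toNNReal
      exact ⟨x, (hlt t ht).eventually hx⟩
    · exact ⟨_, hneg ω t ht⟩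
  · rcases lt_or_ge 0 t with ht0 | ht0
    · exact (hlt t ht0).eventually (hω t ht ht0)
    · exact hneg ω t ht0

theorem survivalProd_eq_chainProd (t : ℝ≥0) (n : ℕ) (ω : Ω) :
    survivalProd p0 π Q (t / n) (fun s => X s.toNNReal ω) n = chainProd p0 π Q X (t / n) n ω := by
  refine Finset.prod_congr rfl fun k _ => ?_
  have e : ((k : ℝ) * ((t : ℝ) / n)).toNNReal = k * (t / n) := by
    have : (k : ℝ) * ((t : ℝ) / n) = ((k * (t / n) : ℝ≥0) : ℝ) := by push_cast; rfl
    rw [this, Real.toNNReal_coe]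
  simp only [e]
  push_cast
  rfl

theorem IsMarkovChain.ae_tendsto_chainProd (hQ : IsIrreducibleGenerator Q)
    (hπ : IsStationary Q π) (hp0 : p0 ∈ stdSimplex ℝ S) (hX : IsMarkovChain P X p0 Q) (t : ℝ≥0) :
    ∀ᵐ ω ∂P, Tendsto (fun n : ℕ => chainProd p0 π Q X (t / n) n ω) atTop
      (𝓝 (J p0 π Q X t ω)) := by
  filter_upwards [hX.ae_isGoodPath hQ hp0 π] with ω hω
  have := tendsto_survivalProd_J hQ hπ hp0 hω t
  simpa only [survivalProd_eq_chainProd] using this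

theorem IsMarkovChain.aemeasurable_J (hQ : IsIrreducibleGenerator Q)
    (hπ : IsStationary Q π) (hp0 : p0 ∈ stdSimplex ℝ S) (hX : IsMarkovChain P X p0 Q) (t : ℝ≥0) :
    AEMeasurable (J p0 π Q X t) P :=
  aemeasurable_of_tendsto_metrizable_ae atTop
    (fun n : ℕ => (measurable_chainProd hX (t / n) n).aemeasurable)
    (hX.ae_tendsto_chainProd hQ hπ hp0 t)

variable {U : Ω → ℝ}

theorem ae_lt_stopTime_iff (hQ : IsIrreducibleGenerator Q) (hπ : IsStationary Q π)
    (hp0 : p0 ∈ stdSimplex ℝ S) (hX : IsMarkovChain P X p0 Q) (hU : Measurable U)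
    (hUlaw : P.map U = volume.restrict (Icc (0 : ℝ) 1)) :
    ∀ᵐ ω ∂P, ∀ t : ℝ≥0, (t : ℝ≥0∞) < stopTime p0 π Q X U ω ↔ U ω < J p0 π Q X t ω := by
  filter_upwards [hX.ae_isGoodPath hQ hp0 π, ae_mem_Icc_of_uniform hU hUlaw] with ω hω hω2 t
  exact lt_stopTime_iff hQ hπ hp0 hω hω2.1 t

theorem nullMeasurableSet_lt_stopTime (hQ : IsIrreducibleGenerator Q) (hπ : IsStationary Q π)
    (hp0 : p0 ∈ stdSimplex ℝ S) (hX : IsMarkovChain P X p0 Q) (hU : Measurable U)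
    (hUlaw : P.map U = volume.restrict (Icc (0 : ℝ) 1)) (t : ℝ≥0) :
    NullMeasurableSet {ω | (t : ℝ≥0∞) < stopTime p0 π Q X U ω} P := by
  have h := nullMeasurableSet_lt hU.aemeasurable (hX.aemeasurable_J (π := π) hQ hπ hp0 t)
  refine h.congr ?_
  filter_upwards [ae_lt_stopTime_iff hQ hπ hp0 hX hU hUlaw] with ω hω
  exact propext (hω t).symm

/-- The central identity, with a later time `s` included so that the chain can be followed after
time `t`. -/
theorem measureReal_lt_stopTime_pair (hQ : IsIrreducibleGenerator Q) (hπ : IsStationary Q π)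
    (hp0 : p0 ∈ stdSimplex ℝ S) (hX : IsMarkovChain P X p0 Q) (hU : Measurable U)
    (hUlaw : P.map U = volume.restrict (Icc (0 : ℝ) 1))
    (hUX : IndepFun U (fun ω t => X t ω) P) {t s : ℝ≥0} (hts : t ≤ s) (y x : S) :
    P.real {ω | (t : ℝ≥0∞) < stopTime p0 π Q X U ω ∧ X t ω = y ∧ X s ω = x} =
      excess p0 π Q t y * transition Q ((s : ℝ) - t) y x := by
  set B : Set Ω := {ω | X t ω = y ∧ X s ω = x} with hB
  set B' : Set (ℝ≥0 → S) := {p | p t = y ∧ p s = x} with hB'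
  have hBm : MeasurableSet B := (hX.measurable t (measurableSet_singleton y)).inter
    (hX.measurable s (measurableSet_singleton x))
  have hB'm : MeasurableSet B' :=
    (measurable_pi_apply (X := fun _ : ℝ≥0 => S) t (measurableSet_singleton y)).inter
      (measurable_pi_apply (X := fun _ : ℝ≥0 => S) s (measurableSet_singleton x))
  set w : ℕ → (ℝ≥0 → S) → ℝ := fun n p => B'.indicator (fun p =>
    ∏ k ∈ Finset.range (n + 1), factor p0 π Q (t / n : ℝ≥0) k (p (k * (t / n)))) p with hw
  have hwm : ∀ n, Measurable (w n) := fun n =>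
    Measurable.indicator (Finset.measurable_fun_prod _ fun k _ =>
      (Measurable.of_discrete (f := factor p0 π Q (t / n : ℝ≥0) k)).comp
        (measurable_pi_apply _)) hB'm
  have hwX : ∀ n ω, w n (fun r => X r ω) = B.indicator (chainProd p0 π Q X (t / n) n) ω :=
    fun n ω => rfl
  -- A genuinely measurable function of the path that equals `J_t` on `B` and `0` off it, almost
  -- surely. Independence from `U` passes to `W`, whereas `J_t` is only known to be almost
  -- everywhere measurable.
  set W : Ω → ℝ := fun ω => limsup (fun n => w n fun r => X r ω) atTop with hW
  have hXm : Measurable fun ω r => X r ω := measurable_pi_lambda _ hX.measurable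
  have hlimsup : Measurable fun p : ℝ≥0 → S => limsup (fun n => w n p) atTop :=
    Measurable.limsup hwm
  have hWm : Measurable W := hlimsup.comp hXm
  have hindep : IndepFun U W P := hUX.comp measurable_id hlimsup
  have hlim : ∀ᵐ ω ∂P, Tendsto (fun n => w n fun r => X r ω) atTop
      (𝓝 (B.indicator (J p0 π Q X t) ω)) := by
    filter_upwards [hX.ae_tendsto_chainProd (π := π) hQ hπ hp0 t] with ω hω
    simp only [hwX]
    by_cases hωB : ω ∈ B
    · simpa only [indicator_of_mem hωB] using hω
    · simp only [indicator_of_notMem hωB]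
      exact tendsto_const_nhds
  have hWJ : ∀ᵐ ω ∂P, W ω = B.indicator (J p0 π Q X t) ω := hlim.mono fun ω hω => hω.limsup_eq
  have hw01 : ∀ n ω, w n (fun r => X r ω) ∈ Icc (0 : ℝ) 1 := by
    intro n ω
    rw [hwX]
    have h := chainProd_mem_Icc (X := X) hQ hπ hp0 (t / n) n ω
    by_cases hωB : ω ∈ B
    · rwa [indicator_of_mem hωB]
    · rw [indicator_of_notMem hωB]; simp
  have hW01 : ∀ᵐ ω ∂P, W ω ∈ Icc (0 : ℝ) 1 := by
    filter_upwards [hWJ, hlim] with ω h1 h2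
    rw [h1]
    exact isClosed_Icc.mem_of_tendsto h2 (Eventually.of_forall fun n => hw01 n ω)
  have hset : P.real {ω | (t : ℝ≥0∞) < stopTime p0 π Q X U ω ∧ X t ω = y ∧ X s ω = x} =
      P.real {ω | U ω < W ω} := by
    refine measureReal_congr ?_
    filter_upwards [ae_lt_stopTime_iff hQ hπ hp0 hX hU hUlaw, hWJ,
      ae_mem_Icc_of_uniform hU hUlaw] with ω h1 h2 h3
    refine propext ?_
    change ((t : ℝ≥0∞) < stopTime p0 π Q X U ω ∧ ω ∈ B) ↔ U ω < W ω
    rw [h2, h1 t]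
    by_cases hωB : ω ∈ B
    · simp [hωB]
    · simp [hωB, h3.1]
  rw [hset, measureReal_lt_eq_integral hU hUlaw hWm hW01 hindep]
  have hT : Tendsto (fun n => ∫ ω, w n (fun r => X r ω) ∂P) atTop (𝓝 (∫ ω, W ω ∂P)) := by
    refine tendsto_integral_of_dominated_convergence (fun _ => 1)
      (fun n => ((hwm n).comp hXm).aestronglyMeasurable) (integrable_const 1)
      (fun n => ae_of_all _ fun ω => ?_) ?_
    · rw [Real.norm_eq_abs, abs_of_nonneg (hw01 n ω).1]
      exact (hw01 n ω).2
    · filter_upwards [hlim, hWJ] with ω h1 h2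
      rwa [h2]
  -- For every `n > 0` the integral already has the claimed value, because `t` is the last point of
  -- the grid of mesh `t / n`.
  refine tendsto_nhds_unique hT (tendsto_const_nhds.congr' ?_)
  filter_upwards [eventually_gt_atTop 0] with n hn
  have hn' : (n : ℝ≥0) ≠ 0 := by exact_mod_cast hn.ne'
  have e : (n : ℝ≥0) * (t / n) = t := by field_simp
  have eR : (n : ℝ) * ((t / n : ℝ≥0) : ℝ) = t := by exact_mod_cast congrArg NNReal.toReal e
  simp only [hwX]
  rw [integral_indicator hBm]
  have h1 := hX.setIntegral_chainProd_pair (π := π) (t / n) n (s := s) (by rwa [e]) y x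
  rw [hX.setIntegral_chainProd hQ hπ hp0] at h1
  rw [e, eR] at h1
  exact h1.symm

end AlmostSurePaths

theorem tendsto_measureReal_of_ae_eventually {Ω : Type*} [MeasurableSpace Ω] {P : Measure Ω}
    [IsFiniteMeasure P] {E : ℕ → Set Ω} {A : Set Ω} (hE : ∀ n, NullMeasurableSet (E n) P)
    (h : ∀ᵐ ω ∂P, ∀ᶠ n in atTop, (ω ∈ E n ↔ ω ∈ A)) :
    Tendsto (fun n => P.real (E n)) atTop (𝓝 (P.real A)) := by
  have hA : NullMeasurableSet A P := nullMeasurableSet_of_tendsto_indicator atTop hE h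
  have e : ∀ {B : Set Ω}, NullMeasurableSet B P →
      P.real B = ∫ ω, B.indicator (fun _ => (1 : ℝ)) ω ∂P := by
    intro B hB
    rw [integral_indicator₀ hB, setIntegral_const, smul_eq_mul, mul_one]
  simp only [e hA, e (hE _)]
  refine tendsto_integral_of_dominated_convergence (fun _ => 1)
    (fun n => aestronglyMeasurable_const.indicator₀ (hE n)) (integrable_const 1)
    (fun n => ae_of_all _ fun ω => ?_) ?_
  · by_cases hω : ω ∈ E n
    · simp [hω]
    · simp [hω]
  · filter_upwards [h] with ω hω
    refine tendsto_const_nhds.congr' ?_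
    filter_upwards [hω] with n hn
    by_cases hA : ω ∈ A
    · rw [indicator_of_mem hA, indicator_of_mem (hn.2 hA)]
    · rw [indicator_of_notMem hA, indicator_of_notMem fun hE => hA (hn.1 hE)]

/-! ### The joint law of the stopping time and the stopped state -/

section StoppingLaw

variable {S : Type*} [Fintype S] [DecidableEq S] [MeasurableSpace S] [MeasurableSingletonClass S]
  {Ω : Type*} [MeasurableSpace Ω]

/-- The standing assumptions: a Markov chain with an irreducible generator and an independent
uniform random variable. -/
structure StoppingSetup (P : Measure Ω) (Q : Matrix S S ℝ) (π p0 : S → ℝ) (X : ℝ≥0 → Ω → S)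
    (U : Ω → ℝ) : Prop where
  generator : IsIrreducibleGenerator Q
  stationary : IsStationary Q π
  initial : p0 ∈ stdSimplex ℝ S
  chain : IsMarkovChain P X p0 Q
  measurable : Measurable U
  uniform : P.map U = volume.restrict (Icc (0 : ℝ) 1)
  indep : IndepFun U (fun ω t => X t ω) P

variable {P : Measure Ω} [IsProbabilityMeasure P] {Q : Matrix S S ℝ} {π p0 : S → ℝ}
  {X : ℝ≥0 → Ω → S} {U : Ω → ℝ}

namespace StoppingSetup

theorem measurableSet_state (h : StoppingSetup P Q π p0 X U) (t : ℝ≥0) (x : S) :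
    MeasurableSet {ω | X t ω = x} :=
  h.chain.measurable t (measurableSet_singleton x)

theorem nullMeasurableSet_lt (h : StoppingSetup P Q π p0 X U) (t : ℝ≥0) :
    NullMeasurableSet {ω | (t : ℝ≥0∞) < stopTime p0 π Q X U ω} P :=
  nullMeasurableSet_lt_stopTime h.generator h.stationary h.initial h.chain h.measurable h.uniform t

theorem nullMeasurableSet_le (h : StoppingSetup P Q π p0 X U) (t : ℝ≥0) :
    NullMeasurableSet {ω | stopTime p0 π Q X U ω ≤ t} P := by
  have := (h.nullMeasurableSet_lt t).compl
  simpa only [compl_ofPred, not_lt] using this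

theorem measureReal_lt_and (h : StoppingSetup P Q π p0 X U) {t s : ℝ≥0} (hts : t ≤ s) (x : S) :
    P.real {ω | (t : ℝ≥0∞) < stopTime p0 π Q X U ω ∧ X s ω = x} =
      (excess p0 π Q t ᵥ* transition Q ((s : ℝ) - t)) x := by
  rw [measureReal_eq_sum_fiber (h.chain.measurable t)]
  refine Finset.sum_congr rfl fun y _ => ?_
  rw [← measureReal_lt_stopTime_pair h.generator h.stationary h.initial h.chain h.measurable
    h.uniform h.indep hts]
  congr 1
  ext ω
  simp only [mem_inter_iff, mem_ofPred_eq]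
  tauto

/-- Complement of the survival formula, using `π_s = π_t P_{s-t}`. It says that after stopping the
chain keeps moving with the same transitions. -/
theorem measureReal_le_and (h : StoppingSetup P Q π p0 X U) {t s : ℝ≥0} (hts : t ≤ s) (x : S) :
    P.real {ω | stopTime p0 π Q X U ω ≤ t ∧ X s ω = x} =
      ((marg p0 Q t ⊓ π) ᵥ* transition Q ((s : ℝ) - t)) x := by
  have h1 := measureReal_inter_add_sdiff₀ (s := {ω | X s ω = x}) (h.nullMeasurableSet_lt t)
  have e1 : {ω | X s ω = x} ∩ {ω | (t : ℝ≥0∞) < stopTime p0 π Q X U ω} =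
      {ω | (t : ℝ≥0∞) < stopTime p0 π Q X U ω ∧ X s ω = x} := inter_comm _ _
  have e2 : {ω | X s ω = x} \ {ω | (t : ℝ≥0∞) < stopTime p0 π Q X U ω} =
      {ω | stopTime p0 π Q X U ω ≤ t ∧ X s ω = x} := by
    ext ω
    simp only [Set.mem_sdiff, mem_ofPred_eq, not_lt]
    tauto
  rw [e1, e2, h.measureReal_lt_and hts, h.chain.measureReal_marg] at h1
  rw [marg_inf_eq_sub_excess, Matrix.sub_vecMul, Pi.sub_apply, ← marg_add, add_sub_cancel]
  linarith

theorem measureReal_lt (h : StoppingSetup P Q π p0 X U) (t : ℝ≥0) :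
    P.real {ω | (t : ℝ≥0∞) < stopTime p0 π Q X U ω} = tv (marg p0 Q t) π := by
  rw [tv_marg h.generator h.stationary h.initial, measureReal_eq_sum_fiber (h.chain.measurable t)]
  refine Finset.sum_congr rfl fun x _ => ?_
  have := h.measureReal_lt_and (le_refl t) x
  rw [sub_self, transition_zero, Matrix.vecMul_one] at this
  exact this

theorem measureReal_le_state (h : StoppingSetup P Q π p0 X U) (t : ℝ≥0) (x : S) :
    P.real {ω | stopTime p0 π Q X U ω ≤ t ∧ X t ω = x} = (marg p0 Q t ⊓ π) x := by
  rw [h.measureReal_le_and le_rfl, sub_self, transition_zero, Matrix.vecMul_one]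

/-- The probability of `T = ∞` is at most that of `T > n`, a total variation distance that tends to
zero. -/
theorem ae_stopTime_lt_top (h : StoppingSetup P Q π p0 X U) :
    ∀ᵐ ω ∂P, stopTime p0 π Q X U ω < ∞ := by
  rw [ae_iff]
  have hle : P.real {ω | ¬ stopTime p0 π Q X U ω < ∞} ≤ 0 := by
    refine ge_of_tendsto (tendsto_sum_excess h.generator h.stationary h.initial)
      (Eventually.of_forall fun n => ?_)
    have := h.measureReal_lt n
    rw [tv_marg h.generator h.stationary h.initial, NNReal.coe_natCast] at this
    rw [← this]
    refine measureReal_mono fun ω hω => ?_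
    have : stopTime p0 π Q X U ω = ∞ := not_lt_top_iff.1 hω
    simp [this]
  exact (measureReal_eq_zero_iff (measure_ne_top _ _)).1 (le_antisymm hle measureReal_nonneg)

/-- The event that the chain is at `x` at the first time of the grid of mesh `r` after the stopping
time, when this occurs within `n` steps. -/
def gridEvent (p0 π : S → ℝ) (Q : Matrix S S ℝ) (X : ℝ≥0 → Ω → S) (U : Ω → ℝ) (r : ℝ≥0) (n : ℕ)
    (x : S) : Set Ω :=
  {ω | stopTime p0 π Q X U ω ≤ (0 : ℝ≥0) ∧ X 0 ω = x} ∪ ⋃ k ∈ Finset.range n,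
    ({ω | stopTime p0 π Q X U ω ≤ ((k + 1 : ℕ) * r : ℝ≥0) ∧ X ((k + 1 : ℕ) * r) ω = x} \
      {ω | stopTime p0 π Q X U ω ≤ (k * r : ℝ≥0)})

theorem nullMeasurableSet_gridPiece (h : StoppingSetup P Q π p0 X U) (r : ℝ≥0) (x : S) (k : ℕ) :
    NullMeasurableSet ({ω | stopTime p0 π Q X U ω ≤ ((k + 1 : ℕ) * r : ℝ≥0) ∧
      X ((k + 1 : ℕ) * r) ω = x} \ {ω | stopTime p0 π Q X U ω ≤ (k * r : ℝ≥0)}) P :=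
  ((h.nullMeasurableSet_le _).inter (h.measurableSet_state _ x).nullMeasurableSet).diff
    (h.nullMeasurableSet_le _)

theorem nullMeasurableSet_gridEvent (h : StoppingSetup P Q π p0 X U) (r : ℝ≥0) (n : ℕ) (x : S) :
    NullMeasurableSet (gridEvent p0 π Q X U r n x) P :=
  ((h.nullMeasurableSet_le _).inter (h.measurableSet_state _ x).nullMeasurableSet).union
    (NullMeasurableSet.biUnion (Finset.range n).countable_toSet fun k _ =>
      h.nullMeasurableSet_gridPiece r x k)

/-- The pieces are disjoint, and the `k`-th is the event `T ≤ (k + 1) r` minus `T ≤ k r`, both with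
the state `x` read at time `(k + 1) r`. -/
theorem measureReal_gridEvent (h : StoppingSetup P Q π p0 X U) (r : ℝ≥0) (n : ℕ) (x : S) :
    P.real (gridEvent p0 π Q X U r n x) = (p0 ⊓ π) x + ∑ k ∈ Finset.range n,
      ((marg p0 Q ((k + 1 : ℕ) * r) ⊓ π) x -
        ((marg p0 Q (k * r) ⊓ π) ᵥ* transition Q r) x) := by
  have hle : ∀ k : ℕ, (k : ℝ≥0) * r ≤ (k + 1 : ℕ) * r := fun k => by
    gcongr; exact Nat.le_succ k
  rw [gridEvent, measureReal_union₀ _ _ (measure_ne_top _ _) (measure_ne_top _ _),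
    measureReal_biUnion_finset₀]
  · congr 1
    · rw [h.measureReal_le_state, NNReal.coe_zero, marg_zero]
    · refine Finset.sum_congr rfl fun k _ => ?_
      have h1 := measureReal_inter_add_sdiff₀
        (s := {ω | stopTime p0 π Q X U ω ≤ ((k + 1 : ℕ) * r : ℝ≥0) ∧ X ((k + 1 : ℕ) * r) ω = x})
        (h.nullMeasurableSet_le (k * r))
      have e : {ω | stopTime p0 π Q X U ω ≤ ((k + 1 : ℕ) * r : ℝ≥0) ∧ X ((k + 1 : ℕ) * r) ω = x} ∩
          {ω | stopTime p0 π Q X U ω ≤ (k * r : ℝ≥0)} =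
          {ω | stopTime p0 π Q X U ω ≤ (k * r : ℝ≥0) ∧ X ((k + 1 : ℕ) * r) ω = x} := by
        ext ω
        simp only [mem_inter_iff, mem_ofPred_eq]
        exact ⟨fun h => ⟨h.2, h.1.2⟩, fun h' =>
          ⟨⟨h'.1.trans (ENNReal.coe_le_coe.2 (hle k)), h'.2⟩, h'.1⟩⟩
      rw [e, h.measureReal_le_state, h.measureReal_le_and (hle k)] at h1
      have e2 : (((k + 1 : ℕ) * r : ℝ≥0) : ℝ) - ((k * r : ℝ≥0) : ℝ) = r := by push_cast; ring
      rw [e2] at h1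
      push_cast at h1 ⊢
      linarith
  · intro i _ j _ hij
    refine Disjoint.aedisjoint (Set.disjoint_left.2 fun ω hi hj => ?_)
    have key : ∀ {a b : ℕ}, a < b → stopTime p0 π Q X U ω ≤ ((a + 1 : ℕ) * r : ℝ≥0) →
        stopTime p0 π Q X U ω ≤ (b * r : ℝ≥0) := fun {a b} hab hT =>
      hT.trans (ENNReal.coe_le_coe.2 (by gcongr; exact hab))
    rcases lt_or_gt_of_ne hij with hlt | hlt
    · exact hj.2 (key hlt hi.1.1)
    · exact hi.2 (key hlt hj.1.1)
  · exact fun k _ => h.nullMeasurableSet_gridPiece r x k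
  · exact NullMeasurableSet.biUnion (Finset.range n).countable_toSet fun k _ =>
      h.nullMeasurableSet_gridPiece r x k
  · refine Disjoint.aedisjoint (Set.disjoint_left.2 fun ω h0 hU => ?_)
    simp only [mem_iUnion] at hU
    obtain ⟨k, _, hk⟩ := hU
    exact hk.2 (h0.1.trans (ENNReal.coe_le_coe.2 (zero_le)))

/-- Replacing `(π_s ∧ π) P_h` by `π_s ∧ π + h * minFlow` leaves a telescoping sum minus a Riemann
sum, with `n` errors of order `(t / n) ^ 2`. -/
theorem tendsto_measureReal_gridEvent (h : StoppingSetup P Q π p0 X U) (t : ℝ≥0) (x : S) :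
    Tendsto (fun n : ℕ => P.real (gridEvent p0 π Q X U (t / n) n x)) atTop
      (𝓝 ((marg p0 Q t ⊓ π) x - ∫ s in (0 : ℝ)..t, minFlow p0 π Q s x)) := by
  have hR := (tendsto_riemann_sum (f := fun s => minFlow p0 π Q s x) t.coe_nonneg
    (fun s hs => abs_minFlow_le h.generator h.stationary h.initial hs.1 x)
    fun s _ => (continuous_minFlow x).continuousAt.tendsto.mono_left nhdsWithin_le_nhds).2
  set R : ℕ → ℝ := fun n => ∑ k ∈ Finset.range n,
    (t : ℝ) / n * minFlow p0 π Q ((k + 1 : ℕ) * ((t : ℝ) / n)) x with hRdef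
  have hdiff : Tendsto (fun n : ℕ => P.real (gridEvent p0 π Q X U (t / n) n x) -
      ((marg p0 Q t ⊓ π) x - R n)) atTop (𝓝 0) := by
    refine squeeze_zero_norm' (a := fun n : ℕ => secondOrderConst Q * t * ((t : ℝ) / n)) ?_ ?_
    · filter_upwards [eventually_gt_atTop 0] with n hn
      have hn' : (0 : ℝ) < n := by exact_mod_cast hn
      have hh : 0 ≤ (t : ℝ) / n := by positivity
      have htel := Finset.sum_range_sub (fun k : ℕ => (marg p0 Q (k * ((t : ℝ) / n)) ⊓ π) x) n
      have e : (n : ℝ) * ((t : ℝ) / n) = t := by field_simp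
      rw [e, Nat.cast_zero, zero_mul, marg_zero] at htel
      have e2 : ((t / n : ℝ≥0) : ℝ) = (t : ℝ) / n := by push_cast; rfl
      rw [h.measureReal_gridEvent, e2]
      have e3 : (p0 ⊓ π) x + ∑ k ∈ Finset.range n,
          ((marg p0 Q ((k + 1 : ℕ) * ((t : ℝ) / n)) ⊓ π) x -
          ((marg p0 Q (k * ((t : ℝ) / n)) ⊓ π) ᵥ* transition Q ((t : ℝ) / n)) x) -
          ((marg p0 Q t ⊓ π) x - R n) = -∑ k ∈ Finset.range n,
          (((marg p0 Q (k * ((t : ℝ) / n)) ⊓ π) ᵥ* transition Q ((t : ℝ) / n)) x -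
            (marg p0 Q (k * ((t : ℝ) / n)) ⊓ π) x -
            (t : ℝ) / n * minFlow p0 π Q ((k + 1 : ℕ) * ((t : ℝ) / n)) x) := by
        simp only [Finset.sum_sub_distrib, hRdef] at htel ⊢
        linarith
      rw [e3, norm_neg, Real.norm_eq_abs]
      refine (Finset.abs_sum_le_sum_abs _ _).trans ?_
      refine (Finset.sum_le_card_nsmul _ _ (secondOrderConst Q * ((t : ℝ) / n) ^ 2)
        fun k _ => ?_).trans (le_of_eq ?_)
      · have := abs_marg_inf_vecMul_sub_le h.generator h.stationary h.initial
          (s := k * ((t : ℝ) / n)) (by positivity) hh x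
        rw [Nat.cast_succ, add_mul, one_mul]
        exact this
      · rw [Finset.card_range, nsmul_eq_mul]
        field_simp
    · simpa using (tendsto_div_natCast (t : ℝ)).const_mul (secondOrderConst Q * t)
  simpa using hdiff.add (hR.const_sub ((marg p0 Q t ⊓ π) x))

/-- The first grid time not before `T` decreases to `T` within ever smaller distance, so by
right-continuity the state there is eventually `X_T`. -/
theorem ae_eventually_mem_gridEvent_iff (h : StoppingSetup P Q π p0 X U) (t : ℝ≥0) (x : S) :
    ∀ᵐ ω ∂P, ∀ᶠ n : ℕ in atTop, (ω ∈ gridEvent p0 π Q X U (t / n) n x ↔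
      ω ∈ {ω | stopTime p0 π Q X U ω ≤ t ∧
        stoppedState X (stopTime p0 π Q X U) ω = x}) := by
  filter_upwards [h.chain.ae_isGoodPath h.generator h.initial π] with ω hω
  simp only [gridEvent, stoppedState, mem_union, mem_iUnion, Set.mem_sdiff, mem_ofPred_eq, not_le,
    exists_prop, Finset.mem_range]
  set T := stopTime p0 π Q X U ω with hT
  by_cases hTt : T ≤ t
  swap
  · filter_upwards [eventually_gt_atTop 0] with n hn
    have hn' : (n : ℝ≥0) ≠ 0 := by exact_mod_cast hn.ne'
    refine iff_of_false ?_ fun h' => hTt h'.1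
    rintro (h0 | ⟨k, hk, h1, -⟩)
    · exact hTt (h0.1.trans (ENNReal.coe_le_coe.2 zero_le))
    · refine hTt (h1.1.trans (ENNReal.coe_le_coe.2 ?_))
      calc ((k + 1 : ℕ) : ℝ≥0) * (t / n) ≤ n * (t / n) := by gcongr; exact hk
        _ = t := by field_simp
  lift T to ℝ≥0 using ne_top_of_le_ne_top ENNReal.coe_ne_top hTt with τ hτ
  simp only [ENNReal.coe_le_coe, ENNReal.coe_lt_coe, ENNReal.toNNReal_coe] at hTt ⊢
  rcases eq_zero_or_pos (a := τ) with h0 | hpos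
  · refine Eventually.of_forall fun n => ?_
    simp [h0]
  have ht : (0 : ℝ) < t := by exact_mod_cast hpos.trans_le hTt
  have hconst := (tendsto_natCeil_div_mul τ.coe_nonneg ht).eventually (hω.eventually_ge τ)
  filter_upwards [hconst, eventually_gt_atTop 0] with n hn hn0
  have hn' : (0 : ℝ) < n := by exact_mod_cast hn0
  have hh : 0 < (t : ℝ) / n := by positivity
  set i := ⌈(τ : ℝ) / ((t : ℝ) / n)⌉₊ with hi
  have hin : i ≤ n := natCeil_div_le (by exact_mod_cast hTt) ht hn0
  have hi0 : 0 < i := Nat.ceil_pos.2 (div_pos (by exact_mod_cast hpos) hh)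
  have eX : ((i : ℝ) * ((t : ℝ) / n)).toNNReal = i * (t / n) := by
    have : (i : ℝ) * ((t : ℝ) / n) = ((i * (t / n) : ℝ≥0) : ℝ) := by push_cast; rfl
    rw [this, Real.toNNReal_coe]
  simp only [eX, Real.toNNReal_coe] at hn
  -- Exactly one piece of the grid event can contain the sample point: the one whose right end is
  -- the ceiling of `τ` on the grid.
  have hchar : ∀ k : ℕ, (τ ≤ ((k + 1 : ℕ) : ℝ≥0) * (t / n) ∧ (k : ℝ≥0) * (t / n) < τ) ↔
      i = k + 1 := by
    intro k
    rw [hi, Nat.ceil_eq_iff (Nat.succ_ne_zero k), lt_div_iff₀ hh, div_le_iff₀ hh,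
      ← NNReal.coe_le_coe, ← NNReal.coe_lt_coe]
    push_cast
    tauto
  constructor
  · rintro (h0 | ⟨k, hk, h1, h2⟩)
    · exact absurd h0.1 (not_le.2 hpos)
    · have := (hchar k).1 ⟨h1.1, h2⟩
      rw [this, h1.2] at hn
      exact ⟨hTt, hn.symm⟩
  · rintro ⟨-, hx⟩
    obtain ⟨k, hk⟩ : ∃ k, i = k + 1 := ⟨i - 1, by omega⟩
    have h1 := (hchar k).2 hk
    rw [hk] at hn
    exact Or.inr ⟨k, by omega, ⟨h1.1, hn.trans hx⟩, h1.2⟩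

theorem nullMeasurableSet_le_stoppedState (h : StoppingSetup P Q π p0 X U) (t : ℝ≥0) (x : S) :
    NullMeasurableSet {ω | stopTime p0 π Q X U ω ≤ t ∧
      stoppedState X (stopTime p0 π Q X U) ω = x} P :=
  nullMeasurableSet_of_tendsto_indicator atTop
    (fun n : ℕ => h.nullMeasurableSet_gridEvent (t / n) n x) (h.ae_eventually_mem_gridEvent_iff t x)

theorem measureReal_le_stoppedState (h : StoppingSetup P Q π p0 X U) (t : ℝ≥0) (x : S) :
    P.real {ω | stopTime p0 π Q X U ω ≤ t ∧ stoppedState X (stopTime p0 π Q X U) ω = x} =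
      (marg p0 Q t ⊓ π) x - ∫ s in (0 : ℝ)..t, minFlow p0 π Q s x :=
  tendsto_nhds_unique
    (tendsto_measureReal_of_ae_eventually (fun n : ℕ => h.nullMeasurableSet_gridEvent (t / n) n x)
      (h.ae_eventually_mem_gridEvent_iff t x))
    (h.tendsto_measureReal_gridEvent t x)

theorem aemeasurable_stopTime (h : StoppingSetup P Q π p0 X U) :
    AEMeasurable (stopTime p0 π Q X U) P := by
  have h1 : Measurable[NullMeasurableSpace.instMeasurableSpace (μ := P)]
      (stopTime p0 π Q X U) := by
    refine @measurable_of_Ioi _ _ _ _ _ NullMeasurableSpace.instMeasurableSpace _ _ _ _ fun a => ?_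
    induction a with
    | top => simp
    | coe a => exact h.nullMeasurableSet_lt a
  exact NullMeasurable.aemeasurable fun s hs => h1 hs

/-- As `T` is almost surely finite, preimages are, up to null sets, countable unions of the events
`T ≤ n`, `X_T = x`. -/
theorem aemeasurable_stoppedState (h : StoppingSetup P Q π p0 X U) :
    AEMeasurable (stoppedState X (stopTime p0 π Q X U)) P := by
  refine NullMeasurable.aemeasurable fun A _ => ?_
  have e : (⋃ x : A, ⋃ n : ℕ, {ω | stopTime p0 π Q X U ω ≤ (n : ℝ≥0) ∧
      stoppedState X (stopTime p0 π Q X U) ω = x}) =ᵐ[P]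
      stoppedState X (stopTime p0 π Q X U) ⁻¹' A := by
    filter_upwards [h.ae_stopTime_lt_top] with ω hω
    refine propext ⟨fun hm => ?_, fun hm => ?_⟩
    · obtain ⟨x, hm⟩ := mem_iUnion.1 hm
      obtain ⟨n, -, hm⟩ := mem_iUnion.1 hm
      exact mem_preimage.2 (hm ▸ x.2)
    · obtain ⟨n, hn⟩ := ENNReal.exists_nat_gt hω.ne
      exact mem_iUnion.2 ⟨⟨_, hm⟩, mem_iUnion.2 ⟨n, by simpa using hn.le, rfl⟩⟩
  exact (NullMeasurableSet.iUnion fun x : A => NullMeasurableSet.iUnion fun n : ℕ =>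
    h.nullMeasurableSet_le_stoppedState n x).congr e

end StoppingSetup

end StoppingLaw

/-! ### Identification of the law with `stopLaw` -/

section LawIdentification

/-- Rays with finite endpoint determine everything except the mass at `∞`, which is why both
measures are required not to charge it. -/
theorem measure_ext_of_Iic_coe {μ ν : Measure ℝ≥0∞} [IsFiniteMeasure μ]
    (h : ∀ t : ℝ≥0, μ (Iic (t : ℝ≥0∞)) = ν (Iic (t : ℝ≥0∞))) (hμ : μ {∞} = 0) (hν : ν {∞} = 0) :
    μ = ν := by
  refine Measure.ext_of_Iic μ ν fun a => ?_
  induction a with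
  | coe t => exact h t
  | top =>
    have e : (Iic ∞ : Set ℝ≥0∞) = (⋃ n : ℕ, Iic (((n : ℝ≥0) : ℝ≥0∞))) ∪ {∞} := by
      ext a
      simp only [mem_Iic, le_top, mem_union, mem_iUnion, mem_singleton_iff, true_iff]
      by_cases ha : a = ∞
      · exact Or.inr ha
      · obtain ⟨n, hn⟩ := ENNReal.exists_nat_gt ha
        exact Or.inl ⟨n, by simpa using hn.le⟩
    have hmono : Monotone fun n : ℕ => Iic (((n : ℝ≥0) : ℝ≥0∞)) := fun m n hmn =>
      Iic_subset_Iic.2 (ENNReal.coe_le_coe.2 (Nat.cast_le.2 hmn))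
    have hunion : ∀ {ρ : Measure ℝ≥0∞} (B : Set ℝ≥0∞), ρ {∞} = 0 → ρ (B ∪ {∞}) = ρ B :=
      fun B hρ => le_antisymm ((measure_union_le _ _).trans (by rw [hρ, add_zero]))
        (measure_mono subset_union_left)
    rw [e, hunion _ hμ, hunion _ hν]
    refine tendsto_nhds_unique (tendsto_measure_iUnion_atTop hmono) ?_
    refine (tendsto_measure_iUnion_atTop (μ := ν) hmono).congr fun n => ?_
    exact (h n).symm

theorem measure_prod_ext_of_singleton {α S : Type*} [MeasurableSpace α] [Countable S]
    [MeasurableSpace S] [MeasurableSingletonClass S] {μ ν : Measure (α × S)} [IsFiniteMeasure μ]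
    (h : ∀ (A : Set α) (x : S), MeasurableSet A → μ (A ×ˢ {x}) = ν (A ×ˢ {x})) : μ = ν := by
  refine Measure.ext_prod fun {A B} hA _ => ?_
  have e : A ×ˢ B = ⋃ x : B, A ×ˢ {(x : S)} := by
    ext ⟨a, y⟩
    simp only [mem_prod, mem_iUnion, mem_singleton_iff]
    exact ⟨fun hy => ⟨⟨y, hy.2⟩, hy.1, rfl⟩, fun ⟨x, ha, hx⟩ => ⟨ha, hx ▸ x.2⟩⟩
  have hd : Pairwise (Function.onFun Disjoint fun x : B => A ×ˢ {(x : S)}) := by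
    intro x y hxy
    refine Set.disjoint_left.2 fun z hz1 hz2 => hxy (Subtype.ext ?_)
    exact (mem_singleton_iff.1 hz1.2).symm.trans hz2.2
  have hm : ∀ x : B, MeasurableSet (A ×ˢ {(x : S)}) := fun x =>
    hA.prod (measurableSet_singleton _)
  rw [e, measure_iUnion hd hm, measure_iUnion hd hm]
  exact tsum_congr fun x => h A x hA

variable {S : Type*} [Fintype S] [DecidableEq S] [MeasurableSpace S] [MeasurableSingletonClass S]
  {Q : Matrix S S ℝ} {π p0 : S → ℝ}

theorem stopLaw_prod_singleton {A : Set ℝ≥0∞} (hA : MeasurableSet A) (x : S) :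
    stopLaw p0 π Q (A ×ˢ {x}) = ENNReal.ofReal ((p0 ⊓ π) x) * A.indicator 1 0 +
      ∫⁻ s in ENNReal.ofReal ⁻¹' A ∩ Ici 0, ENNReal.ofReal (stopDensity p0 π Q s x) := by
  have hAx : MeasurableSet (A ×ˢ {x}) := hA.prod (measurableSet_singleton x)
  have hmap : ∀ y : S, Measurable fun s : ℝ => (ENNReal.ofReal s, y) := fun y =>
    ENNReal.measurable_ofReal.prodMk measurable_const
  rw [stopLaw, Measure.finsetSum_apply, Finset.sum_eq_single x]
  · rw [Measure.add_apply, Measure.smul_apply, Measure.dirac_apply' _ hAx,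
      Measure.map_apply (hmap x) hAx]
    have e : (fun s : ℝ => (ENNReal.ofReal s, x)) ⁻¹' A ×ˢ {x} = ENNReal.ofReal ⁻¹' A := by
      ext s; simp
    rw [e, withDensity_apply _ (ENNReal.measurable_ofReal hA),
      Measure.restrict_restrict (ENNReal.measurable_ofReal hA), smul_eq_mul]
    congr 2
    by_cases h0 : (0 : ℝ≥0∞) ∈ A
    · rw [indicator_of_mem h0, indicator_of_mem (by simpa using h0)]; rfl
    · rw [indicator_of_notMem h0, indicator_of_notMem (by simpa using h0)]
  · intro y _ hy
    rw [Measure.add_apply, Measure.smul_apply, Measure.dirac_apply' _ hAx,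
      Measure.map_apply (hmap y) hAx]
    have e : (fun s : ℝ => (ENNReal.ofReal s, y)) ⁻¹' A ×ˢ {x} = ∅ := by
      ext s; simp [hy]
    rw [e, measure_empty, indicator_of_notMem (by simp [hy])]
    simp
  · simp

theorem stopLaw_Iic_prod (hQ : IsIrreducibleGenerator Q) (hπ : IsStationary Q π)
    (hp0 : p0 ∈ stdSimplex ℝ S) (t : ℝ≥0) (x : S) :
    stopLaw p0 π Q (Iic (t : ℝ≥0∞) ×ˢ {x}) =
      ENNReal.ofReal ((marg p0 Q t ⊓ π) x - ∫ s in (0 : ℝ)..t, minFlow p0 π Q s x) := by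
  rw [stopLaw_prod_singleton measurableSet_Iic]
  have e : ENNReal.ofReal ⁻¹' Iic (t : ℝ≥0∞) ∩ Ici 0 = Icc (0 : ℝ) t := by
    ext s
    simp only [mem_inter_iff, mem_preimage, mem_Iic, mem_Ici, mem_Icc]
    rw [ENNReal.ofReal_le_iff_le_toReal ENNReal.coe_ne_top, ENNReal.coe_toReal, and_comm]
  have hnn : 0 ≤ ∫ s in (0 : ℝ)..t, stopDensity p0 π Q s x :=
    intervalIntegral.integral_nonneg t.coe_nonneg fun s _ => stopDensity_nonneg hQ hπ s x
  have hint : ∫⁻ s in Icc (0 : ℝ) t, ENNReal.ofReal (stopDensity p0 π Q s x) =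
      ENNReal.ofReal (∫ s in (0 : ℝ)..t, stopDensity p0 π Q s x) := by
    have hi := intervalIntegrable_stopDensity (p0 := p0) (π := π) (Q := Q) x 0 t
    rw [intervalIntegrable_iff_integrableOn_Ioc_of_le t.coe_nonneg] at hi
    rw [intervalIntegral.integral_of_le t.coe_nonneg, ← Measure.restrict_congr_set Ioc_ae_eq_Icc,
      ofReal_integral_eq_lintegral_ofReal hi (ae_of_all _ fun s => stopDensity_nonneg hQ hπ s x)]
  have h0 : 0 ≤ (p0 ⊓ π) x := le_inf (hp0.1 x) (hπ.prob.1 x)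
  rw [e, hint, indicator_of_mem (by simp), Pi.one_apply, mul_one,
    ← ENNReal.ofReal_add h0 hnn, integral_stopDensity]
  congr 1
  ring

theorem stopLaw_top_prod (x : S) : stopLaw p0 π Q ({∞} ×ˢ {x}) = 0 := by
  rw [stopLaw_prod_singleton (measurableSet_singleton _)]
  have e : ENNReal.ofReal ⁻¹' {∞} = ∅ := by
    ext s; simp
  simp [e]

variable {Ω : Type*} [MeasurableSpace Ω] {P : Measure Ω} [IsProbabilityMeasure P]
  {X : ℝ≥0 → Ω → S} {U : Ω → ℝ}

theorem StoppingSetup.map_eq_stopLaw (h : StoppingSetup P Q π p0 X U) :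
    P.map (fun ω => (stopTime p0 π Q X U ω, stoppedState X (stopTime p0 π Q X U) ω)) =
      stopLaw p0 π Q := by
  have hm := h.aemeasurable_stopTime.prodMk h.aemeasurable_stoppedState
  set μ := P.map fun ω => (stopTime p0 π Q X U ω, stoppedState X (stopTime p0 π Q X U) ω) with hμ
  have hfin : IsFiniteMeasure μ := by rw [hμ]; infer_instance
  refine measure_prod_ext_of_singleton fun A x hA => ?_
  -- Each slice over a state becomes a measure on `[0, ∞]` alone, where comparison on rays suffices.
  have hslice : ∀ (ρ : Measure (ℝ≥0∞ × S)) {B : Set ℝ≥0∞}, MeasurableSet B →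
      (ρ.restrict (Prod.snd ⁻¹' {x})).map Prod.fst B = ρ (B ×ˢ {x}) := by
    intro ρ B hB
    rw [Measure.map_apply measurable_fst hB, Measure.restrict_apply (measurable_fst hB)]
    rfl
  rw [← hslice μ hA, ← hslice _ hA]
  congr 1
  refine measure_ext_of_Iic_coe (fun t => ?_) ?_ ?_
  · rw [hslice _ measurableSet_Iic, hslice _ measurableSet_Iic,
      stopLaw_Iic_prod h.generator h.stationary h.initial, ← h.measureReal_le_stoppedState,
      ofReal_measureReal, hμ, Measure.map_apply_of_aemeasurable hm
        (measurableSet_Iic.prod (measurableSet_singleton x))]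
    rfl
  · rw [hslice _ (measurableSet_singleton _), hμ, Measure.map_apply_of_aemeasurable hm
      ((measurableSet_singleton _).prod (measurableSet_singleton x))]
    refine measure_mono_null (fun ω hω => ?_) (ae_iff.1 h.ae_stopTime_lt_top)
    have h1 : stopTime p0 π Q X U ω = ∞ := hω.1
    simp [h1]
  · rw [hslice _ (measurableSet_singleton _), stopLaw_top_prod]

end LawIdentification

end OptStop

theorem mainTheorem3 {S : Type*} [Fintype S] [DecidableEq S] [MeasurableSpace S]
    [MeasurableSingletonClass S] {Ω : Type*} [MeasurableSpace Ω]
    (P : Measure Ω) [IsProbabilityMeasure P]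
    (Q : Matrix S S ℝ) (hQ : OptStop.IsIrreducibleGenerator Q)
    (π : S → ℝ) (hπ : OptStop.IsStationary Q π)
    (p0 : S → ℝ) (hp0 : p0 ∈ stdSimplex ℝ S)
    (X : ℝ≥0 → Ω → S) (hX : OptStop.IsMarkovChain P X p0 Q)
    (U : Ω → ℝ) (hU : Measurable U) (hUlaw : P.map U = volume.restrict (Icc (0 : ℝ) 1))
    (hUX : IndepFun U (fun ω t => X t ω) P)
    (T : Ω → ℝ≥0∞) (hT : T = OptStop.stopTime p0 π Q X U) :
    (∀ t : ℝ≥0, OptStop.tv (OptStop.marg p0 Q t) π = P.real {ω | (t : ℝ≥0∞) < T ω}) ∧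
    (∀ (t : ℝ≥0) (x : S),
      P.real {ω | T ω ≤ t ∧ X t ω = x} = (OptStop.marg p0 Q t ⊓ π) x) ∧
    (∀ (t : ℝ≥0) (x : S),
      P.real {ω | T ω ≤ t ∧ OptStop.stoppedState X T ω = x} =
        (OptStop.marg p0 Q t ⊓ π) x - ∫ s in (0 : ℝ)..t, OptStop.minFlow p0 π Q s x) ∧
    (∀ᵐ ω ∂P, T ω < ∞) ∧
    (∀ (s : ℝ) (x : S), 0 ≤ s → 0 ≤ OptStop.stopDensity p0 π Q s x) ∧
    AEMeasurable (fun ω => (T ω, OptStop.stoppedState X T ω)) P ∧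
    P.map (fun ω => (T ω, OptStop.stoppedState X T ω)) = OptStop.stopLaw p0 π Q := by
  subst hT
  have h : OptStop.StoppingSetup P Q π p0 X U := ⟨hQ, hπ, hp0, hX, hU, hUlaw, hUX⟩
  exact ⟨fun t => (h.measureReal_lt t).symm, h.measureReal_le_state,
    h.measureReal_le_stoppedState, h.ae_stopTime_lt_top,
    fun s x _ => OptStop.stopDensity_nonneg hQ hπ s x,
    h.aemeasurable_stopTime.prodMk h.aemeasurable_stoppedState, h.map_eq_stopLaw⟩
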